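/- Let $M$ be a (non-empty, Hausdorff) smooth manifold without boundary. *Definitions.* An almost contact metric structure on $M$ is a tuple $(\varphi,\xi,\eta,g)$ consisting of a smooth $(1,1)$-tensor field $\varphi$, a smooth vector field $\xi$, a smooth $1$-form $\eta$ and a smooth Riemannian metric $g$ with $\varphi^2=-I+\eta\otimes\xi$, $\eta(\xi)=1$ and $g(\varphi X,\varphi Y)=g(X,Y)-\eta(X)\eta(Y)$; its fundamental $2$-form is $\Omega(X,Y)=g(X,\varphi Y)$. It is a Sasakian structure if it is normal, i.e. $[\varphi,\varphi]+2\,d\eta\otimes\xi=0$, and $d\eta=\Omega$; here $2\,d\eta(X,Y)=X(\eta(Y))-Y(\eta(X))-\eta([X,Y])$ and $[\varphi,\varphi](X,Y)=\varphi^2[X,Y]+[\varphi X,\varphi Y]-\varphi[\varphi X,Y]-\varphi[X,\varphi Y]$. A $3$-Sasakian structure on $M$ consists of three Sasakian structures $(\varphi_\alpha,\xi_\alpha,\eta_\alpha,g)$, $\alpha=1,2,3$, with the same metric $g$, such that for every even permutation $(\alpha,\beta,\gamma)$ of $(1,2,3)$ $$\varphi_\gamma=\varphi_\alpha\varphi_\beta-\eta_\beta\otimes\xi_\alpha=-\varphi_\beta\varphi_\alpha+\eta_\alpha\otimes\xi_\beta,\quad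 \xi_\gamma=\varphi_\alpha\xi_\beta=-\varphi_\beta\xi_\alpha,\quad \eta_\gamma=\eta_\alpha\circ\varphi_\beta=-\eta_\beta\circ\varphi_\alpha .$$ An almost cosymplectic structure on a manifold of dimension $2k+1$ is a pair $(\eta,\Omega)$ of a $1$-form and a $2$-form such that $\eta\wedge\Omega^k$ is a volume form; its Reeb vector field is the vector field $\xi$ with $\eta(\xi)=1$, $i_\xi\Omega=0$. Almost cosymplectic structures $(\eta_1,\Omega_1),\dots,(\eta_{p+1},\Omega_{p+1})$ generate an almost cosymplectic $p$-sphere if $(\eta_\lambda,\Omega_\lambda):=(\sum_i\lambda_i\eta_i,\sum_i\lambda_i\Omega_i)$ is an almost cosymplectic structure for every $\lambda\in\mathbb S^p$. The $p$-sphere is taut if $\eta_\lambda\wedge\Omega_\lambda^k=\eta_{\lambda'}\wedge\Omega_{\lambda'}^k$ for all $\lambda,\lambda'\in\mathbb S^p$, and round if, $\xi_i$ being the Reeb vector field of $(\eta_i,\Omega_i)$, $\sum_i\lambda_i\xi_i$ is the Reeb vector field of $(\eta_\lambda,\Omega_\lambda)$ for every $\lambda\in\mathbb S^p$. An almost cosymplectic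 sphere is an almost cosymplectic $2$-sphere. **Statement.** Every $3$-Sasakian manifold $(M,\varphi_\alpha,\xi_\alpha,\eta_\alpha,g)_{\alpha=1,2,3}$ admits an almost cosymplectic sphere consisting of Sasakian structures which is both taut and round. Namely, let $\Omega_\alpha=g(\cdot,\varphi_\alpha\cdot)$. Then $(\eta_1,\Omega_1),(\eta_2,\Omega_2),(\eta_3,\Omega_3)$ generate an almost cosymplectic sphere on $M$ (in particular $\dim M$ is odd); this sphere is taut and round; and for every $\lambda=(\lambda_1,\lambda_2,\lambda_3)\in\mathbb S^2$ the tuple $(\sum_\alpha\lambda_\alpha\varphi_\alpha,\ \sum_\alpha\lambda_\alpha\xi_\alpha,\ \eta_\lambda,\ g)$ is a Sasakian structure whose fundamental $2$-form is $\Omega_\lambda$. -/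

import Mathlib

open scoped Manifold ContDiff Bundle

noncomputable section

/-! ### Tensor fields on a `d`-dimensional smooth manifold -/

/-- (Not necessarily smooth) vector fields on `M`. -/
abbrev VField (d : ℕ) (M : Type*) [TopologicalSpace M]
    [ChartedSpace (EuclideanSpace ℝ (Fin d)) M] :=
  (x : M) → TangentSpace (𝓡 d) x

/-- Fields of linear forms on the tangent spaces of `M`. -/
abbrev CovField (d : ℕ) (M : Type*) [TopologicalSpace M]
    [ChartedSpace (EuclideanSpace ℝ (Fin d)) M] :=
  (x : M) → (TangentSpace (𝓡 d) x →L[ℝ] ℝ)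

/-- Fields of bilinear forms on the tangent spaces of `M`. -/
abbrev BilinField (d : ℕ) (M : Type*) [TopologicalSpace M]
    [ChartedSpace (EuclideanSpace ℝ (Fin d)) M] :=
  (x : M) → (TangentSpace (𝓡 d) x →L[ℝ] TangentSpace (𝓡 d) x →L[ℝ] ℝ)

/-- Fields of endomorphisms of the tangent spaces of `M`. -/
abbrev EndField (d : ℕ) (M : Type*) [TopologicalSpace M]
    [ChartedSpace (EuclideanSpace ℝ (Fin d)) M] :=
  (x : M) → (TangentSpace (𝓡 d) x →L[ℝ] TangentSpace (𝓡 d) x)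

/- Two shortcuts for type class inference. -/
instance cotangent_isTopologicalAddGroup {d : ℕ} {M : Type*} [TopologicalSpace M]
    [ChartedSpace (EuclideanSpace ℝ (Fin d)) M] (x : M) :
    IsTopologicalAddGroup (TangentSpace (𝓡 d) x →L[ℝ] ℝ) :=
  ContinuousLinearMap.topologicalAddGroup

instance cotangent_continuousAdd {d : ℕ} {M : Type*} [TopologicalSpace M]
    [ChartedSpace (EuclideanSpace ℝ (Fin d)) M] (x : M) :
    ContinuousAdd (TangentSpace (𝓡 d) x →L[ℝ] ℝ) :=
  (cotangent_isTopologicalAddGroup x).toContinuousAdd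

/-- Smooth Riemannian metrics on `M`. -/
abbrev SmoothMetric (d : ℕ) (M : Type*) [TopologicalSpace M]
    [ChartedSpace (EuclideanSpace ℝ (Fin d)) M] [IsManifold (𝓡 d) ∞ M] :=
  Bundle.ContMDiffRiemannianMetric (𝓡 d) ∞ (EuclideanSpace ℝ (Fin d))
    (fun x : M => TangentSpace (𝓡 d) x)

section Fields

variable {d : ℕ} {M : Type*} [TopologicalSpace M] [ChartedSpace (EuclideanSpace ℝ (Fin d)) M]
  [IsManifold (𝓡 d) ∞ M]

/-- `X` is a smooth section of the tangent bundle. -/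
def VField.Smooth (X : VField d M) : Prop :=
  ContMDiff (𝓡 d) ((𝓡 d).prod 𝓘(ℝ, EuclideanSpace ℝ (Fin d))) ∞
    (fun x => Bundle.TotalSpace.mk' (EuclideanSpace ℝ (Fin d)) x (X x))

/-- `η` is a smooth `1`-form. -/
def CovField.Smooth (η : CovField d M) : Prop :=
  ContMDiff (𝓡 d) ((𝓡 d).prod 𝓘(ℝ, EuclideanSpace ℝ (Fin d) →L[ℝ] ℝ)) ∞
    (fun x => Bundle.TotalSpace.mk' (EuclideanSpace ℝ (Fin d) →L[ℝ] ℝ) x (η x))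

/-- `b` is a smooth section of the bundle of bilinear forms on tangent spaces. -/
def BilinField.Smooth (b : BilinField d M) : Prop :=
  ContMDiff (𝓡 d)
    ((𝓡 d).prod 𝓘(ℝ, EuclideanSpace ℝ (Fin d) →L[ℝ] EuclideanSpace ℝ (Fin d) →L[ℝ] ℝ)) ∞
    (fun x => Bundle.TotalSpace.mk'
      (EuclideanSpace ℝ (Fin d) →L[ℝ] EuclideanSpace ℝ (Fin d) →L[ℝ] ℝ) x (b x))

/-- `φ` is a smooth tensor field of type `(1,1)`. -/
def EndField.Smooth (φ : EndField d M) : Prop :=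
  ContMDiff (𝓡 d)
    ((𝓡 d).prod 𝓘(ℝ, EuclideanSpace ℝ (Fin d) →L[ℝ] EuclideanSpace ℝ (Fin d))) ∞
    (fun x => Bundle.TotalSpace.mk'
      (EuclideanSpace ℝ (Fin d) →L[ℝ] EuclideanSpace ℝ (Fin d)) x (φ x))

/-- `Ω` is a smooth differential `2`-form. -/
structure IsTwoForm (Ω : BilinField d M) : Prop where
  smooth : Ω.Smooth
  alternating : ∀ (x : M) (v : TangentSpace (𝓡 d) x), Ω x v v = 0

end Fields

/-! ### The form `η ∧ Ω ^ k` on a vector space -/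

section Wedge

variable {V : Type*} [AddCommGroup V] [Module ℝ V] [TopologicalSpace V]

/-- The multilinear map
`(v₀, …, v₂ₖ) ↦ η v₀ * Ω (v₁, v₂) * Ω (v₃, v₄) * ⋯ * Ω (v₂ₖ₋₁, v₂ₖ)`. -/
def tensorOneTwoPow (k : ℕ) (η : V →L[ℝ] ℝ) (Ω : V →L[ℝ] V →L[ℝ] ℝ) :
    MultilinearMap ℝ (fun _ : Fin (2 * k + 1) => V) ℝ where
  toFun v := η (v 0) * ∏ j : Fin k,
    Ω (v ⟨2 * j.1 + 1, by omega⟩) (v ⟨2 * j.1 + 2, by omega⟩)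
  map_update_add' := by
    intro dec v i x y
    have hdec : dec = instDecidableEqFin _ := Subsingleton.elim _ _
    subst hdec
    rcases i with ⟨i, hi⟩
    rcases Nat.eq_zero_or_pos i with rfl | hpos
    · have h0 : (⟨0, hi⟩ : Fin (2 * k + 1)) = 0 := rfl
      simp [h0, Fin.ext_iff, add_mul]
    · obtain ⟨j, hj⟩ : ∃ j : Fin k, i = 2 * j.1 + 1 ∨ i = 2 * j.1 + 2 :=
        ⟨⟨(i - 1) / 2, by omega⟩, by dsimp only; omega⟩
      simp only [← Finset.mul_prod_erase Finset.univ _ (Finset.mem_univ j)]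
      have hout : ∀ z : V, ∏ l ∈ Finset.univ.erase j,
          Ω (Function.update v ⟨i, hi⟩ z ⟨2 * l.1 + 1, by omega⟩)
            (Function.update v ⟨i, hi⟩ z ⟨2 * l.1 + 2, by omega⟩) =
          ∏ l ∈ Finset.univ.erase j,
            Ω (v ⟨2 * l.1 + 1, by omega⟩) (v ⟨2 * l.1 + 2, by omega⟩) := by
        intro z
        refine Finset.prod_congr rfl fun l hl => ?_
        have hlj : l.1 ≠ j.1 := fun h => (Finset.mem_erase.mp hl).1 (Fin.ext h)
        rw [Function.update_of_ne (by simp only [ne_eq, Fin.mk.injEq]; omega),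
          Function.update_of_ne (by simp only [ne_eq, Fin.mk.injEq]; omega)]
      have hzero : ∀ z : V, Function.update v ⟨i, hi⟩ z 0 = v 0 := fun z =>
        Function.update_of_ne (by simp only [ne_eq, Fin.ext_iff, Fin.val_zero]; omega) _ _
      simp only [hout, hzero]
      rcases hj with rfl | rfl <;> simp <;> ring
  map_update_smul' := by
    intro dec v i c x
    have hdec : dec = instDecidableEqFin _ := Subsingleton.elim _ _
    subst hdec
    rcases i with ⟨i, hi⟩
    rcases Nat.eq_zero_or_pos i with rfl | hpos
    · have h0 : (⟨0, hi⟩ : Fin (2 * k + 1)) = 0 := rfl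
      simp [h0, Fin.ext_iff, mul_assoc]
    · obtain ⟨j, hj⟩ : ∃ j : Fin k, i = 2 * j.1 + 1 ∨ i = 2 * j.1 + 2 :=
        ⟨⟨(i - 1) / 2, by omega⟩, by dsimp only; omega⟩
      simp only [← Finset.mul_prod_erase Finset.univ _ (Finset.mem_univ j)]
      have hout : ∀ z : V, ∏ l ∈ Finset.univ.erase j,
          Ω (Function.update v ⟨i, hi⟩ z ⟨2 * l.1 + 1, by omega⟩)
            (Function.update v ⟨i, hi⟩ z ⟨2 * l.1 + 2, by omega⟩) =
          ∏ l ∈ Finset.univ.erase j,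
            Ω (v ⟨2 * l.1 + 1, by omega⟩) (v ⟨2 * l.1 + 2, by omega⟩) := by
        intro z
        refine Finset.prod_congr rfl fun l hl => ?_
        have hlj : l.1 ≠ j.1 := fun h => (Finset.mem_erase.mp hl).1 (Fin.ext h)
        rw [Function.update_of_ne (by simp only [ne_eq, Fin.mk.injEq]; omega),
          Function.update_of_ne (by simp only [ne_eq, Fin.mk.injEq]; omega)]
      have hzero : ∀ z : V, Function.update v ⟨i, hi⟩ z 0 = v 0 := fun z =>
        Function.update_of_ne (by simp only [ne_eq, Fin.ext_iff, Fin.val_zero]; omega) _ _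
      simp only [hout, hzero]
      rcases hj with rfl | rfl <;> simp <;> ring

/-- The exterior product `η ∧ Ω ∧ ⋯ ∧ Ω` (`k` factors `Ω`) of a linear form with the `k`-th power
of an alternating bilinear form:
`(η ∧ Ω ^ k) (v₀, …, v₂ₖ) = (1 / 2 ^ k) ∑ σ, sign σ * η v_{σ 0} * Ω (v_{σ 1}, v_{σ 2}) ⋯`,
the sum being over all permutations of `{0, …, 2k}`. -/
def wedgeOneTwoPow (k : ℕ) (η : V →L[ℝ] ℝ) (Ω : V →L[ℝ] V →L[ℝ] ℝ) :
    V [⋀^Fin (2 * k + 1)]→ₗ[ℝ] ℝ :=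
  (1 / 2 ^ k : ℝ) • MultilinearMap.alternatization (tensorOneTwoPow k η Ω)

end Wedge

/-! ### Almost cosymplectic structures and spheres -/

section Cosymplectic

variable {d : ℕ} {M : Type*} [TopologicalSpace M] [ChartedSpace (EuclideanSpace ℝ (Fin d)) M]
  [IsManifold (𝓡 d) ∞ M]

/-- `(η, Ω)` is an almost cosymplectic structure on the `(2k+1)`-dimensional manifold `M`:
`η` is a `1`-form, `Ω` a `2`-form, and `η ∧ Ω ^ k` is a volume form (a form of top degree
without zeros). -/
structure IsAlmostCosymplectic (k : ℕ) (η : CovField d M) (Ω : BilinField d M) : Prop where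
  dim_eq : d = 2 * k + 1
  smooth_one : η.Smooth
  two_form : IsTwoForm Ω
  volume : ∀ x : M, wedgeOneTwoPow k (η x) (Ω x) ≠ 0

/-- `ξ` is the Reeb vector field of `(η, Ω)`. -/
structure IsReeb (η : CovField d M) (Ω : BilinField d M) (ξ : VField d M) : Prop where
  smooth : ξ.Smooth
  one : ∀ x : M, η x (ξ x) = 1
  two : ∀ x : M, Ω x (ξ x) = 0

/-- The unit sphere `S^p` in `ℝ^{p+1}`. -/
abbrev USphere (p : ℕ) := Metric.sphere (0 : EuclideanSpace ℝ (Fin (p + 1))) 1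

/-- The combination `s_λ = λ₁ s₁ + ⋯ + λ_{p+1} s_{p+1}` of a tuple of tensor fields of the same
type. -/
def sphereComb {p : ℕ} {V : M → Type*} [∀ x, AddCommMonoid (V x)] [∀ x, Module ℝ (V x)]
    (l : USphere p) (s : Fin (p + 1) → (x : M) → V x) : (x : M) → V x :=
  fun x => ∑ i, l.1 i • s i x

/-- `(η₁, Ω₁), …, (η_{p+1}, Ω_{p+1})` generate an almost cosymplectic `p`-sphere. -/
structure IsAlmostCosymplecticSphere (k : ℕ) {p : ℕ} (η : Fin (p + 1) → CovField d M)
    (Ω : Fin (p + 1) → BilinField d M) : Prop where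
  generators : ∀ i, IsAlmostCosymplectic k (η i) (Ω i)
  members : ∀ l : USphere p, IsAlmostCosymplectic k (sphereComb l η) (sphereComb l Ω)

/-- Tautness: all members of the `p`-sphere give the same volume form. -/
def IsTautSphere (k : ℕ) {p : ℕ} (η : Fin (p + 1) → CovField d M)
    (Ω : Fin (p + 1) → BilinField d M) : Prop :=
  ∀ (l l' : USphere p) (x : M),
    wedgeOneTwoPow k (sphereComb l η x) (sphereComb l Ω x) =
      wedgeOneTwoPow k (sphereComb l' η x) (sphereComb l' Ω x)

/-- Roundness: if `ξᵢ` is the Reeb vector field of `(ηᵢ, Ωᵢ)`, then for every point `λ` of the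
sphere `λ₁ ξ₁ + ⋯ + λ_{p+1} ξ_{p+1}` is the Reeb vector field of `(η_λ, Ω_λ)`. -/
def IsRoundSphere {p : ℕ} (η : Fin (p + 1) → CovField d M)
    (Ω : Fin (p + 1) → BilinField d M) : Prop :=
  ∃ ξ : Fin (p + 1) → VField d M, (∀ i, IsReeb (η i) (Ω i) (ξ i)) ∧
    ∀ l : USphere p, IsReeb (sphereComb l η) (sphereComb l Ω) (sphereComb l ξ)

end Cosymplectic

/-! ### Sasakian and 3-Sasakian structures -/

section Sasakian

variable {d : ℕ} {M : Type*} [TopologicalSpace M] [ChartedSpace (EuclideanSpace ℝ (Fin d)) M]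
  [IsManifold (𝓡 d) ∞ M]

/-- The exterior derivative of a `1`-form, evaluated on vector fields, with the normalization
`2 dη(X, Y) = X (η Y) - Y (η X) - η [X, Y]` customary in contact metric geometry. -/
def dOne (η : CovField d M) (X Y : VField d M) (x : M) : ℝ :=
  (1 / 2 : ℝ) *
    (mvfderiv (𝓡 d) (fun y => η y (Y y)) x (X x)
      - mvfderiv (𝓡 d) (fun y => η y (X y)) x (Y x)
      - η x (VectorField.mlieBracket (𝓡 d) X Y x))

/-- The Nijenhuis torsion
`[φ, φ](X, Y) = φ² [X, Y] + [φ X, φ Y] - φ [φ X, Y] - φ [X, φ Y]`. -/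
def nijenhuis (φ : EndField d M) (X Y : VField d M) : VField d M := fun x =>
  φ x (φ x (VectorField.mlieBracket (𝓡 d) X Y x))
    + VectorField.mlieBracket (𝓡 d) (fun y => φ y (X y)) (fun y => φ y (Y y)) x
    - φ x (VectorField.mlieBracket (𝓡 d) (fun y => φ y (X y)) Y x)
    - φ x (VectorField.mlieBracket (𝓡 d) X (fun y => φ y (Y y)) x)

/-- The bilinear form `Ω(X, Y) = g(X, φ Y)`. -/
def fundamentalForm (g : SmoothMetric d M) (φ : EndField d M) : BilinField d M := fun x =>
  (ContinuousLinearMap.precomp ℝ (φ x)).comp (g.inner x)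

theorem fundamentalForm_apply (g : SmoothMetric d M) (φ : EndField d M) (x : M)
    (v w : TangentSpace (𝓡 d) x) : fundamentalForm g φ x v w = g.inner x v (φ x w) := rfl

/-- `(φ, ξ, η)` is an almost contact structure. -/
structure IsAlmostContact (φ : EndField d M) (ξ : VField d M) (η : CovField d M) : Prop where
  smooth_phi : φ.Smooth
  smooth_xi : ξ.Smooth
  smooth_eta : η.Smooth
  phi_phi : ∀ (x : M) (v : TangentSpace (𝓡 d) x), φ x (φ x v) = -v + η x v • ξ x
  eta_xi : ∀ x : M, η x (ξ x) = 1

/-- The Riemannian metric `g` is compatible with `(φ, ξ, η)`. -/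
def IsCompatibleMetric (g : SmoothMetric d M) (φ : EndField d M) (η : CovField d M) : Prop :=
  ∀ (x : M) (v w : TangentSpace (𝓡 d) x),
    g.inner x (φ x v) (φ x w) = g.inner x v w - η x v * η x w

/-- Normality: `[φ, φ] + 2 dη ⊗ ξ = 0`. -/
def IsNormal (φ : EndField d M) (ξ : VField d M) (η : CovField d M) : Prop :=
  ∀ X Y : VField d M, X.Smooth → Y.Smooth →
    ∀ x : M, nijenhuis φ X Y x + (2 * dOne η X Y x) • ξ x = 0

/-- `(φ, ξ, η, g)` is a Sasakian structure: a normal almost contact metric structure such that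
`dη` is its fundamental `2`-form. -/
structure IsSasakian (φ : EndField d M) (ξ : VField d M) (η : CovField d M)
    (g : SmoothMetric d M) : Prop where
  almost_contact : IsAlmostContact φ ξ η
  compatible : IsCompatibleMetric g φ η
  normal : IsNormal φ ξ η
  contact : ∀ X Y : VField d M, X.Smooth → Y.Smooth →
    ∀ x : M, dOne η X Y x = fundamentalForm g φ x (X x) (Y x)

/-- The quaternionic-type relations of an almost contact `3`-structure. With indices in `Fin 3`
(arithmetic modulo `3`) the even permutations are `(α, α + 1, α + 2)`. -/
structure ThreeStructureRelations (φ : Fin 3 → EndField d M) (ξ : Fin 3 → VField d M)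
    (η : Fin 3 → CovField d M) : Prop where
  phi_left : ∀ (a : Fin 3) (x : M) (v : TangentSpace (𝓡 d) x),
    φ (a + 2) x v = φ a x (φ (a + 1) x v) - η (a + 1) x v • ξ a x
  phi_right : ∀ (a : Fin 3) (x : M) (v : TangentSpace (𝓡 d) x),
    φ (a + 2) x v = -φ (a + 1) x (φ a x v) + η a x v • ξ (a + 1) x
  xi_left : ∀ (a : Fin 3) (x : M), ξ (a + 2) x = φ a x (ξ (a + 1) x)
  xi_right : ∀ (a : Fin 3) (x : M), ξ (a + 2) x = -φ (a + 1) x (ξ a x)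
  eta_left : ∀ (a : Fin 3) (x : M) (v : TangentSpace (𝓡 d) x),
    η (a + 2) x v = η a x (φ (a + 1) x v)
  eta_right : ∀ (a : Fin 3) (x : M) (v : TangentSpace (𝓡 d) x),
    η (a + 2) x v = -η (a + 1) x (φ a x v)

/-- `(φ_α, ξ_α, η_α, g)`, `α = 1, 2, 3`, is a 3-Sasakian structure: an almost contact metric
`3`-structure each of whose three members is Sasakian. -/
structure IsThreeSasakian (φ : Fin 3 → EndField d M) (ξ : Fin 3 → VField d M)
    (η : Fin 3 → CovField d M) (g : SmoothMetric d M) : Prop where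
  relations : ThreeStructureRelations φ ξ η
  sasakian : ∀ a, IsSasakian (φ a) (ξ a) (η a) g

end Sasakian

end

/-! For a contact metric structure with Levi-Civita connection `∇`, being Sasakian is equivalent to
`(∇_X φ) Y = g(X, Y) ξ - η(Y) X`. With `g` fixed, this equation and `dη = Ω` are linear in `(φ, ξ,
η)`, so both pass to the combinations indexed by the sphere. The only quadratic conditions are the
almost contact ones. They follow from the anticommutation relations of the `3`-structure and from
`|λ| = 1`.

No connection is constructed: `koszul` stands for `2 g(∇_X Y, Z)`. `IsSasakian.koszul_phi` derives
the equation from `dΩ = 0` and normality, `isNormal_of_koszul_phi` recovers normality from it, and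
`IsThreeSasakian.isSasakian_sphereComb` combines the two.

Each member is thus Sasakian, with Reeb field `∑ λ_i ξ_i`, which gives roundness. For the volume
forms, a maximal unitary family in `ker η` completes to an orthonormal frame `ξ, e_j, -φ e_j`, on
which `η ∧ Ω ^ k` has a positive value depending only on `k`. Two orthonormal frames differ by a
determinant `±1`, so on a fixed frame every member takes this value up to sign. By continuity in `λ`
and connectedness of the sphere the sign is constant, hence tautness (`isTautSphere_of_isSasakian`).
-/

noncomputable section

/-! ### Smooth tensor fields, and functions differentiated along fields -/

section SmoothFields

variable {d : ℕ} {M : Type*} [TopologicalSpace M] [ChartedSpace (EuclideanSpace ℝ (Fin d)) M]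
  [IsManifold (𝓡 d) ∞ M]

instance isManifold_minSmoothness_two : IsManifold (𝓡 d) (minSmoothness ℝ 2) M :=
  IsManifold.of_le (n := ∞) (by
    rw [minSmoothness_of_isRCLikeNormedField]
    exact WithTop.coe_le_coe.2 (le_top : (2 : ℕ∞) ≤ ⊤))

instance isManifold_minSmoothness_three : IsManifold (𝓡 d) (minSmoothness ℝ 3) M :=
  IsManifold.of_le (n := ∞) (by
    rw [minSmoothness_of_isRCLikeNormedField]
    exact WithTop.coe_le_coe.2 (le_top : (3 : ℕ∞) ≤ ⊤))

theorem VField.Smooth.mdifferentiableAt {X : VField d M} (hX : X.Smooth) (x : M) :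
    MDifferentiableAt (𝓡 d) ((𝓡 d).prod 𝓘(ℝ, EuclideanSpace ℝ (Fin d)))
      (fun x => Bundle.TotalSpace.mk' (EuclideanSpace ℝ (Fin d)) x (X x)) x :=
  (hX x).mdifferentiableAt (by simp)

theorem VField.Smooth.smul {f : M → ℝ} {X : VField d M} (hf : ContMDiff (𝓡 d) 𝓘(ℝ, ℝ) ∞ f)
    (hX : X.Smooth) : VField.Smooth (f • X) :=
  ContMDiff.smul_section hf hX

theorem VField.Smooth.mlieBracket {X Y : VField d M} (hX : X.Smooth) (hY : Y.Smooth) :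
    VField.Smooth (VectorField.mlieBracket (𝓡 d) X Y) := by
  -- The bracket costs one derivative, harmless here because `∞ + 1` is `∞` by definition.
  have : IsManifold (𝓡 d) (((⊤ : ℕ∞) : WithTop ℕ∞) + 1) M := ‹IsManifold (𝓡 d) ∞ M›
  exact ContDiff.mlieBracket_vectorField (m := ⊤) (n := ⊤) hX hY (by simp)

theorem CovField.Smooth.apply {η : CovField d M} {X : VField d M} (hη : η.Smooth)
    (hX : X.Smooth) : ContMDiff (𝓡 d) 𝓘(ℝ, ℝ) ∞ (fun x => η x (X x)) := by
  have h := ContMDiff.clm_bundle_apply (E₂ := Bundle.Trivial M ℝ) (F₂ := ℝ) hη hX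
  intro x
  exact ((Bundle.contMDiffAt_totalSpace).1 (h x)).2

theorem EndField.Smooth.apply {φ : EndField d M} {X : VField d M} (hφ : φ.Smooth)
    (hX : X.Smooth) : VField.Smooth (fun x => φ x (X x)) :=
  ContMDiff.clm_bundle_apply hφ hX

theorem BilinField.Smooth.apply {b : BilinField d M} {X Y : VField d M} (hb : b.Smooth)
    (hX : X.Smooth) (hY : Y.Smooth) :
    ContMDiff (𝓡 d) 𝓘(ℝ, ℝ) ∞ (fun x => b x (X x) (Y x)) := by
  have h := ContMDiff.clm_bundle_apply₂ (E₃ := Bundle.Trivial M ℝ) (F₃ := ℝ) hb hX hY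
  intro x
  exact ((Bundle.contMDiffAt_totalSpace).1 (h x)).2

/-- In coordinates the contraction of `g` with `φ` is a composition of smooth operator-valued maps.
The identification is checked on the base set of the trivialization, a neighbourhood of `x₀`. -/
theorem fundamentalForm_smooth (g : SmoothMetric d M) {φ : EndField d M} (hφ : φ.Smooth) :
    (fundamentalForm g φ).Smooth := by
  intro x₀
  have hg := ((contMDiffAt_hom_bundle _).1 (g.contMDiff x₀)).2
  have hf := ((contMDiffAt_hom_bundle _).1 (hφ x₀)).2
  refine (contMDiffAt_hom_bundle _).2 ⟨contMDiffAt_id, ?_⟩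
  refine ((hf.clm_precomp (F₃ := ℝ)).clm_comp hg).congr_of_eventuallyEq ?_
  have hb : ∀ᶠ x in nhds x₀, x ∈ (trivializationAt (EuclideanSpace ℝ (Fin d))
      (fun x : M => TangentSpace (𝓡 d) x) x₀).baseSet :=
    (Bundle.Trivialization.open_baseSet _).eventually_mem
      (FiberBundle.mem_baseSet_trivializationAt' x₀)
  filter_upwards [hb] with x hx
  ext v w
  have h3 : x ∈ (trivializationAt ℝ (Bundle.Trivial M ℝ) x₀).baseSet := Set.mem_univ _
  have h1 := inCoordinates_apply_eq₂ (𝕜 := ℝ) (E₃ := Bundle.Trivial M ℝ) (F₃ := ℝ)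
    (ϕ := fundamentalForm g φ x) (v := v) (w := w) hx hx h3
  have h2 := inCoordinates_apply_eq₂ (𝕜 := ℝ) (E₃ := Bundle.Trivial M ℝ) (F₃ := ℝ)
    (ϕ := g.inner x) (v := v) (w := ContinuousLinearMap.inCoordinates (EuclideanSpace ℝ (Fin d))
      (fun x : M => TangentSpace (𝓡 d) x) (EuclideanSpace ℝ (Fin d))
      (fun x : M => TangentSpace (𝓡 d) x) x₀ x x₀ x (φ x) w) hx hx h3
  refine h1.trans (Eq.trans ?_ h2.symm)
  rw [fundamentalForm_apply, ContinuousLinearMap.inCoordinates_eq hx hx]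
  congr 2
  exact (Bundle.Trivialization.symm_apply_apply_mk _ hx _).symm

/-- A local extension of `v` times a bump function. This lets a pointwise vector be tested against
identities stated for global fields. -/
theorem exists_smooth_vField_eq [T2Space M] (x : M) (v : TangentSpace (𝓡 d) x) :
    ∃ Z : VField d M, Z.Smooth ∧ Z x = v := by
  obtain ⟨s, hs, hsσ⟩ := FiberBundle.exists_contMDiffOn_extend (k := ∞) (𝓡 d)
    (EuclideanSpace ℝ (Fin d)) (V := fun x : M => TangentSpace (𝓡 d) x) v
  obtain ⟨u, hus, huo, hxu⟩ := mem_nhds_iff.1 hs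
  obtain ⟨f, hf, -⟩ := (SmoothBumpFunction.nhds_basis_support (I := 𝓡 d)
    (huo.mem_nhds hxu)).mem_iff.1 (huo.mem_nhds hxu)
  refine ⟨_, ContMDiffOn.smul_section_of_tsupport (f.contMDiff.contMDiffOn (s := u)) huo hf
    (hsσ.mono hus), ?_⟩
  simp

theorem mlieBracket_smul_eq {Y Z : VField d M} {f : M → ℝ}
    (hf : ContMDiff (𝓡 d) 𝓘(ℝ, ℝ) ∞ f) (hZ : Z.Smooth) :
    VectorField.mlieBracket (𝓡 d) Y (f • Z)
      = (fun x => mvfderiv (𝓡 d) f x (Y x)) • Z + f • VectorField.mlieBracket (𝓡 d) Y Z := by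
  funext x
  exact VectorField.mlieBracket_smul_right ((hf x).mdifferentiableAt (by simp))
    (hZ.mdifferentiableAt x)

/-- The derivative of a smooth function along a smooth field is smooth. -/
theorem contMDiff_mvfderiv_apply {X ξ : VField d M} {η : CovField d M} {f : M → ℝ}
    (hη : η.Smooth) (hξ : ξ.Smooth) (hηξ : ∀ x, η x (ξ x) = 1)
    (hf : ContMDiff (𝓡 d) 𝓘(ℝ, ℝ) ∞ f) (hX : X.Smooth) :
    ContMDiff (𝓡 d) 𝓘(ℝ, ℝ) ∞ (fun x => mvfderiv (𝓡 d) f x (X x)) := by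
  -- Pairing `[X, f ξ] = (X f) ξ + f [X, ξ]` with `η` isolates `X f`, because `η ξ = 1`. Smoothness
  -- is then inherited from brackets and pairings.
  have h : (fun x => mvfderiv (𝓡 d) f x (X x)) =
      fun x => η x (VectorField.mlieBracket (𝓡 d) X (f • ξ) x)
        - f x * η x (VectorField.mlieBracket (𝓡 d) X ξ x) := by
    funext x
    rw [mlieBracket_smul_eq hf hξ]
    simp [hηξ]
  rw [h]
  exact (hη.apply (hX.mlieBracket (hξ.smul hf))).sub (hf.mul (hη.apply (hX.mlieBracket hξ)))

/-- The Lie bracket acts on smooth functions as the commutator of derivations. -/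
theorem mvfderiv_mlieBracket {X Y ξ : VField d M} {η : CovField d M} {f : M → ℝ}
    (hη : η.Smooth) (hξ : ξ.Smooth) (hηξ : ∀ x, η x (ξ x) = 1)
    (hf : ContMDiff (𝓡 d) 𝓘(ℝ, ℝ) ∞ f) (hX : X.Smooth) (hY : Y.Smooth) (x : M) :
    mvfderiv (𝓡 d) f x (VectorField.mlieBracket (𝓡 d) X Y x) =
      mvfderiv (𝓡 d) (fun y => mvfderiv (𝓡 d) f y (Y y)) x (X x)
        - mvfderiv (𝓡 d) (fun y => mvfderiv (𝓡 d) f y (X y)) x (Y x) := by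
  have hXf := contMDiff_mvfderiv_apply hη hξ hηξ hf hX
  have hYf := contMDiff_mvfderiv_apply hη hξ hηξ hf hY
  have hle : minSmoothness ℝ 2 ≤ ∞ := by
    rw [minSmoothness_of_isRCLikeNormedField]
    exact WithTop.coe_le_coe.2 (le_top : (2 : ℕ∞) ≤ ⊤)
  have jac : ∀ Z : VField d M, Z.Smooth → _ := fun Z hZ =>
    VectorField.leibniz_identity_mlieBracket_apply (x := x) ((hX x).of_le hle)
      ((hY x).of_le hle) ((ContMDiff.contMDiffAt hZ).of_le hle)
  -- Jacobi for `X, Y, f ξ` minus `f` times Jacobi for `X, Y, ξ` leaves a multiple of `ξ`. Its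
  -- coefficient, read off by `η`, is the claimed identity.
  have h1 := jac _ (hξ.smul hf)
  have h2 := jac _ hξ
  have hadd : ∀ {U V W : VField d M}, V.Smooth → W.Smooth →
      VectorField.mlieBracket (𝓡 d) U (V + W) x =
        VectorField.mlieBracket (𝓡 d) U V x + VectorField.mlieBracket (𝓡 d) U W x :=
    fun hV hW => VectorField.mlieBracket_add_right (hV.mdifferentiableAt x)
      (hW.mdifferentiableAt x)
  rw [mlieBracket_smul_eq hf hξ, mlieBracket_smul_eq hf hξ, mlieBracket_smul_eq hf hξ,
    hadd (hξ.smul hYf) ((hY.mlieBracket hξ).smul hf),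
    hadd (hξ.smul hXf) ((hX.mlieBracket hξ).smul hf),
    mlieBracket_smul_eq hf (hY.mlieBracket hξ), mlieBracket_smul_eq hf (hX.mlieBracket hξ),
    mlieBracket_smul_eq hYf hξ, mlieBracket_smul_eq hXf hξ] at h1
  simp only [Pi.add_apply, Pi.smul_apply', h2] at h1
  have h3 := congrArg (η x) h1
  simp only [map_add, map_smul, hηξ, smul_eq_mul] at h3
  linarith

end SmoothFields

section Derivative

variable {d : ℕ} {M : Type*} [TopologicalSpace M] [ChartedSpace (EuclideanSpace ℝ (Fin d)) M]

theorem mvfderiv_sub_apply {f₁ f₂ : M → ℝ} (h₁ : ContMDiff (𝓡 d) 𝓘(ℝ, ℝ) ∞ f₁)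
    (h₂ : ContMDiff (𝓡 d) 𝓘(ℝ, ℝ) ∞ f₂) (x : M) (v : TangentSpace (𝓡 d) x) :
    mvfderiv (𝓡 d) (fun y => f₁ y - f₂ y) x v =
      mvfderiv (𝓡 d) f₁ x v - mvfderiv (𝓡 d) f₂ x v := by
  have := mvfderiv_sub ((h₁ x).mdifferentiableAt (by simp)) ((h₂ x).mdifferentiableAt (by simp))
  exact congrArg (fun L => L v) this

theorem mvfderiv_mul_apply {f₁ f₂ : M → ℝ} (h₁ : ContMDiff (𝓡 d) 𝓘(ℝ, ℝ) ∞ f₁)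
    (h₂ : ContMDiff (𝓡 d) 𝓘(ℝ, ℝ) ∞ f₂) (x : M) (v : TangentSpace (𝓡 d) x) :
    mvfderiv (𝓡 d) (fun y => f₁ y * f₂ y) x v =
      f₁ x * mvfderiv (𝓡 d) f₂ x v + f₂ x * mvfderiv (𝓡 d) f₁ x v := by
  have := mvfderiv_mul ((h₁ x).mdifferentiableAt (by simp)) ((h₂ x).mdifferentiableAt (by simp))
  have h := congrArg (fun L => L v) this
  simp only [_root_.add_apply, _root_.smul_apply, smul_eq_mul] at h
  exact h

theorem mvfderiv_neg_apply (f : M → ℝ) (x : M) (v : TangentSpace (𝓡 d) x) :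
    mvfderiv (𝓡 d) (fun y => -f y) x v = -mvfderiv (𝓡 d) f x v :=
  congrArg (fun L => L v) (mvfderiv_neg (I := 𝓡 d) (g := f) (x := x))

end Derivative

/-! ### Sasakian structures and the Levi-Civita derivative of `φ` -/

section SasakianLemmas

variable {d : ℕ} {M : Type*} [TopologicalSpace M] [ChartedSpace (EuclideanSpace ℝ (Fin d)) M]
  [IsManifold (𝓡 d) ∞ M]

section Pointwise

variable {φ : EndField d M} {ξ : VField d M} {η : CovField d M} {g : SmoothMetric d M}

/-- From `φ² ξ = 0`, the formula for `φ²` at `φ ξ` gives `φ ξ = c ξ` with `c = η (φ ξ)`. Then `c² ξ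
= φ² ξ = 0` forces `c = 0`. -/
theorem IsAlmostContact.phi_xi (h : IsAlmostContact φ ξ η) (x : M) : φ x (ξ x) = 0 := by
  have h1 : φ x (φ x (ξ x)) = 0 := by rw [h.phi_phi, h.eta_xi]; simp
  have h2 := h.phi_phi x (φ x (ξ x))
  rw [h1, map_zero] at h2
  have h3 : φ x (ξ x) = η x (φ x (ξ x)) • ξ x := (neg_add_eq_zero.1 h2.symm)
  have h4 := h1
  rw [h3, map_smul, h3, smul_smul] at h4
  have h5 := congrArg (η x) h4
  simp only [map_smul, h.eta_xi, map_zero, smul_eq_mul, mul_one, mul_self_eq_zero] at h5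
  rw [h3, h5, zero_smul]

/-- Compute `φ³ v` as `φ² (φ v)` and as `φ (φ² v)`; the two differ by `η (φ v) ξ`. -/
theorem IsAlmostContact.eta_phi (h : IsAlmostContact φ ξ η) (x : M) (v : TangentSpace (𝓡 d) x) :
    η x (φ x v) = 0 := by
  have h1 := h.phi_phi x (φ x v)
  rw [h.phi_phi x v, map_add, map_smul, h.phi_xi, smul_zero, add_zero, map_neg] at h1
  have h2 : η x (φ x v) • ξ x = 0 := by simpa using h1
  have h3 := congrArg (η x) h2
  simpa [h.eta_xi] using h3

theorem IsCompatibleMetric.inner_xi (hg : IsCompatibleMetric g φ η) (h : IsAlmostContact φ ξ η)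
    (x : M) (v : TangentSpace (𝓡 d) x) : g.inner x v (ξ x) = η x v := by
  have h1 := hg x v (ξ x)
  rw [h.phi_xi, map_zero, h.eta_xi] at h1
  linarith

theorem IsCompatibleMetric.skew (hg : IsCompatibleMetric g φ η) (h : IsAlmostContact φ ξ η)
    (x : M) (v w : TangentSpace (𝓡 d) x) : g.inner x (φ x v) w = -g.inner x v (φ x w) := by
  have h1 := hg x (φ x v) w
  rw [h.eta_phi, h.phi_phi, zero_mul, sub_zero, g.symm] at h1
  simp only [map_add, map_neg, map_smul, hg.inner_xi h, h.eta_phi, smul_zero, add_zero] at h1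
  rw [← h1, g.symm]

end Pointwise

/-- Twice the metric product of the Levi-Civita derivative of `Y` along `X` with `Z`, as given by
Koszul's formula. -/
def koszul (g : SmoothMetric d M) (X Y Z : VField d M) (x : M) : ℝ :=
  mvfderiv (𝓡 d) (fun y => g.inner y (Y y) (Z y)) x (X x)
    + mvfderiv (𝓡 d) (fun y => g.inner y (X y) (Z y)) x (Y x)
    - mvfderiv (𝓡 d) (fun y => g.inner y (X y) (Y y)) x (Z x)
    + g.inner x (VectorField.mlieBracket (𝓡 d) X Y x) (Z x)
    - g.inner x (VectorField.mlieBracket (𝓡 d) X Z x) (Y x)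
    - g.inner x (VectorField.mlieBracket (𝓡 d) Y Z x) (X x)

theorem inner_fun_symm (g : SmoothMetric d M) (X Y : VField d M) :
    (fun y => g.inner y (X y) (Y y)) = fun y => g.inner y (Y y) (X y) :=
  funext fun y => g.symm y _ _

/-- This is torsion-freeness, `∇_X Y - ∇_Y X = [X, Y]`. -/
theorem koszul_sub_swap (g : SmoothMetric d M) (X Y Z : VField d M) (x : M) :
    koszul g X Y Z x - koszul g Y X Z x =
      2 * g.inner x (VectorField.mlieBracket (𝓡 d) X Y x) (Z x) := by
  unfold koszul
  rw [VectorField.mlieBracket_swap_apply (V := Y) (W := X), inner_fun_symm g Y X]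
  simp only [map_neg, neg_apply]
  ring

/-- This is metric compatibility, `X g(Y, Z) = g(∇_X Y, Z) + g(Y, ∇_X Z)`. -/
theorem koszul_add_swap (g : SmoothMetric d M) (X Y Z : VField d M) (x : M) :
    koszul g X Y Z x + koszul g X Z Y x =
      2 * mvfderiv (𝓡 d) (fun y => g.inner y (Y y) (Z y)) x (X x) := by
  unfold koszul
  rw [VectorField.mlieBracket_swap_apply (V := Z) (W := Y), inner_fun_symm g Z Y]
  simp only [map_neg, neg_apply]
  ring

section Forward

variable {φ : EndField d M} {ξ : VField d M} {η : CovField d M} {g : SmoothMetric d M}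

theorem two_mul_inner_phi_eq (h : IsSasakian φ ξ η g) {X Y : VField d M} (hX : X.Smooth)
    (hY : Y.Smooth) (x : M) :
    2 * g.inner x (X x) (φ x (Y x)) =
      mvfderiv (𝓡 d) (fun y => η y (Y y)) x (X x)
      - mvfderiv (𝓡 d) (fun y => η y (X y)) x (Y x)
      - η x (VectorField.mlieBracket (𝓡 d) X Y x) := by
  rw [← fundamentalForm_apply, ← h.contact X Y hX hY x, dOne]
  ring

/-- The fundamental form of a Sasakian structure is closed. -/
theorem IsSasakian.closed (h : IsSasakian φ ξ η g) {X Y Z : VField d M} (hX : X.Smooth)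
    (hY : Y.Smooth) (hZ : Z.Smooth) (x : M) :
    mvfderiv (𝓡 d) (fun y => g.inner y (Y y) (φ y (Z y))) x (X x)
      + mvfderiv (𝓡 d) (fun y => g.inner y (Z y) (φ y (X y))) x (Y x)
      + mvfderiv (𝓡 d) (fun y => g.inner y (X y) (φ y (Y y))) x (Z x)
      - g.inner x (VectorField.mlieBracket (𝓡 d) X Y x) (φ x (Z x))
      - g.inner x (VectorField.mlieBracket (𝓡 d) Y Z x) (φ x (X x))
      - g.inner x (VectorField.mlieBracket (𝓡 d) Z X x) (φ x (Y x)) = 0 := by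
  have hη := h.almost_contact.smooth_eta
  have hξ := h.almost_contact.smooth_xi
  have hηξ := h.almost_contact.eta_xi
  have deriv : ∀ {U V W : VField d M}, U.Smooth → V.Smooth → W.Smooth →
      2 * mvfderiv (𝓡 d) (fun y => g.inner y (V y) (φ y (W y))) x (U x) =
        mvfderiv (𝓡 d) (fun y => mvfderiv (𝓡 d) (fun z => η z (W z)) y (V y)) x (U x)
        - mvfderiv (𝓡 d) (fun y => mvfderiv (𝓡 d) (fun z => η z (V z)) y (W y)) x (U x)
        - mvfderiv (𝓡 d) (fun y => η y (VectorField.mlieBracket (𝓡 d) V W y)) x (U x) := by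
    intro U V W hU hV hW
    have hs := fundamentalForm_smooth g h.almost_contact.smooth_phi
    have h1 := contMDiff_mvfderiv_apply hη hξ hηξ (hη.apply hW) hV
    have h2 := contMDiff_mvfderiv_apply hη hξ hηξ (hη.apply hV) hW
    have h3 := hη.apply (hV.mlieBracket hW)
    have h0 := hs.apply hV hW
    simp only [fundamentalForm_apply] at h0
    rw [← mvfderiv_sub_apply h1 h2, ← mvfderiv_sub_apply (h1.sub h2) h3,
      ← funext (two_mul_inner_phi_eq h hV hW),
      mvfderiv_mul_apply (f₁ := fun _ => 2) contMDiff_const h0]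
    simp [mvfderiv_const]
  have e1 := deriv hX hY hZ
  have e2 := deriv hY hZ hX
  have e3 := deriv hZ hX hY
  have f1 := two_mul_inner_phi_eq h (hX.mlieBracket hY) hZ x
  have f2 := two_mul_inner_phi_eq h (hY.mlieBracket hZ) hX x
  have f3 := two_mul_inner_phi_eq h (hZ.mlieBracket hX) hY x
  have b1 := mvfderiv_mlieBracket hη hξ hηξ (hη.apply hZ) hX hY x
  have b2 := mvfderiv_mlieBracket hη hξ hηξ (hη.apply hX) hY hZ x
  have b3 := mvfderiv_mlieBracket hη hξ hηξ (hη.apply hY) hZ hX x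
  have hle : minSmoothness ℝ 2 ≤ ∞ := by
    rw [minSmoothness_of_isRCLikeNormedField]
    exact WithTop.coe_le_coe.2 (le_top : (2 : ℕ∞) ≤ ⊤)
  -- With `Ω = dη` the sum is `d²η`. Second derivatives of `η X`, `η Y`, `η Z` group into
  -- commutators, matched by `b1`, `b2`, `b3`, and the iterated brackets cancel by Jacobi.
  have jac := congrArg (η x) (VectorField.leibniz_identity_mlieBracket_apply (x := x)
      ((hX x).of_le hle) ((hY x).of_le hle) ((hZ x).of_le hle))
  have s1 := congrArg (η x) (VectorField.mlieBracket_swap_apply (I := 𝓡 d) (x := x) (V := X)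
    (W := VectorField.mlieBracket (𝓡 d) Y Z))
  have s2 := congrArg (η x) (VectorField.mlieBracket_swap_apply (I := 𝓡 d) (x := x) (V := Y)
    (W := VectorField.mlieBracket (𝓡 d) Z X))
  rw [VectorField.mlieBracket_swap (V := X) (W := Z)] at jac
  have s3 : VectorField.mlieBracket (𝓡 d) Y (-VectorField.mlieBracket (𝓡 d) Z X) x
      = - VectorField.mlieBracket (𝓡 d) Y (VectorField.mlieBracket (𝓡 d) Z X) x := by
    have := VectorField.mlieBracket_const_smul_right (I := 𝓡 d) (V := Y) (c := (-1 : ℝ))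
      ((hZ.mlieBracket hX).mdifferentiableAt x)
    simpa using this
  rw [map_add, s3, map_neg] at jac
  rw [map_neg] at s1 s2
  linarith

/-- The Levi-Civita derivative of the structure tensor of a Sasakian structure. -/
theorem IsSasakian.koszul_phi (h : IsSasakian φ ξ η g) {X Y Z : VField d M} (hX : X.Smooth)
    (hY : Y.Smooth) (hZ : Z.Smooth) (x : M) :
    koszul g X (fun y => φ y (Y y)) Z x + koszul g X Y (fun y => φ y (Z y)) x =
      2 * (g.inner x (X x) (Y x) * η x (Z x) - η x (Y x) * g.inner x (X x) (Z x)) := by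
  have hφ := h.almost_contact.smooth_phi
  have hη := h.almost_contact.smooth_eta
  have hφY := hφ.apply hY
  have hφZ := hφ.apply hZ
  have skew := h.compatible.skew h.almost_contact
  have ixi := h.compatible.inner_xi h.almost_contact
  have eta_phi := h.almost_contact.eta_phi
  have phi_phi := h.almost_contact.phi_phi
  -- The classical formula for `2 g((∇_X φ) Y, Z)`: it combines `dΩ` at `(X, φ Y, φ Z)` and at `(X,
  -- Y, Z)`, the normality tensor of `(Y, Z)` paired with `φ X`, and values of `dη`. The first three
  -- vanish, and `k1` to `k4` evaluate `dη` by the contact condition, using `η ∘ φ = 0`.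
  have c1 := h.closed hX hY hZ x
  have c2 := h.closed hX hφY hφZ x
  have n := congrArg (fun v => g.inner x v (φ x (X x))) (h.normal Y Z hY hZ x)
  have k1 := two_mul_inner_phi_eq h hφY hX x
  have k2 := two_mul_inner_phi_eq h hφZ hX x
  have k3 := two_mul_inner_phi_eq h hφY hZ x
  have k4 := two_mul_inner_phi_eq h hφZ hY x
  have z : ∀ V : VField d M, (fun y => η y (φ y (V y))) = fun _ => (0 : ℝ) :=
    fun V => funext fun y => eta_phi y _
  have r1 : (fun y => g.inner y (φ y (Y y)) (φ y (φ y (Z y)))) =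
      fun y => g.inner y (Y y) (φ y (Z y)) := by
    funext y; rw [h.compatible, eta_phi]; ring
  have r2 : (fun y => g.inner y (φ y (Z y)) (φ y (X y))) =
      fun y => g.inner y (X y) (Z y) - η y (Z y) * η y (X y) := by
    funext y; rw [h.compatible, g.symm]
  have r3 : (fun y => g.inner y (X y) (φ y (φ y (Y y)))) =
      fun y => η y (Y y) * η y (X y) - g.inner y (X y) (Y y) := by
    funext y; rw [phi_phi, map_add, map_smul, ixi, map_neg, smul_eq_mul]; ring
  have r4 : (fun y => g.inner y (φ y (Y y)) (Z y)) =
      fun y => -g.inner y (Y y) (φ y (Z y)) := funext fun y => skew y _ _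
  have r5 : (fun y => g.inner y (Z y) (φ y (X y))) =
      fun y => -g.inner y (X y) (φ y (Z y)) := by
    funext y; rw [g.symm, skew]
  have hXZ := BilinField.Smooth.apply g.contMDiff hX hZ
  have hXY := BilinField.Smooth.apply g.contMDiff hX hY
  have eX := hη.apply hX
  have eY := hη.apply hY
  have eZ := hη.apply hZ
  have eZX : ContMDiff (𝓡 d) 𝓘(ℝ, ℝ) ∞ fun y => η y (Z y) * η y (X y) := eZ.mul eX
  have eYX : ContMDiff (𝓡 d) 𝓘(ℝ, ℝ) ∞ fun y => η y (Y y) * η y (X y) := eY.mul eX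
  rw [r1, r2, r3, mvfderiv_sub_apply hXZ eZX, mvfderiv_sub_apply eYX hXY,
    mvfderiv_mul_apply eZ eX, mvfderiv_mul_apply eY eX] at c2
  rw [r5, mvfderiv_neg_apply] at c1
  simp only [z, mvfderiv_const, _root_.zero_apply] at k1 k2 k3 k4
  simp only [nijenhuis, map_add, map_sub, map_smul, map_zero, _root_.add_apply,
    _root_.sub_apply, _root_.smul_apply,
    _root_.zero_apply, h.compatible x, eta_phi, g.symm x (ξ x), ixi,
    smul_eq_mul, mul_zero, skew x _ (X x), zero_mul, sub_zero, add_zero] at n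
  simp only [phi_phi, map_add, map_smul, map_neg, ixi, smul_eq_mul] at c2
  simp only [h.compatible x] at k1 k2 k3 k4
  unfold koszul
  rw [r4, mvfderiv_neg_apply, VectorField.mlieBracket_swap_apply (V := X) (W := Z),
    VectorField.mlieBracket_swap_apply (V := X) (W := fun y => φ y (Z y))]
  have sw := VectorField.mlieBracket_swap_apply (I := 𝓡 d) (x := x) (V := Y)
    (W := fun y => φ y (Z y))
  rw [VectorField.mlieBracket_swap_apply (V := fun y => φ y (Y y)) (W := X)] at k1
  rw [sw] at n ⊢
  simp only [map_neg, neg_apply] at *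
  rw [g.symm x (Y x) (X x)] at k1
  rw [g.symm x (Z x) (X x)] at k2
  rw [g.symm x (Z x) (Y x)] at k4
  linear_combination c2 - c1 + n - η x (X x) * (k3 - k4) - η x (Z x) * k1 + η x (Y x) * k2

end Forward

end SasakianLemmas

/-! ### Linearity in the structure, and normality recovered -/

section DerivativeSum

variable {d : ℕ} {M : Type*} [TopologicalSpace M] [ChartedSpace (EuclideanSpace ℝ (Fin d)) M]

theorem mvfderiv_sum_mul_apply {ι : Type*} (s : Finset ι) (c : ι → ℝ) {f : ι → M → ℝ}
    (hf : ∀ i, ContMDiff (𝓡 d) 𝓘(ℝ, ℝ) ∞ (f i)) (x : M) (v : TangentSpace (𝓡 d) x) :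
    mvfderiv (𝓡 d) (fun y => ∑ i ∈ s, c i * f i y) x v =
      ∑ i ∈ s, c i * mvfderiv (𝓡 d) (f i) x v := by
  classical
  induction s using Finset.induction_on with
  | empty => simp [mvfderiv_const]
  | insert a s ha ih =>
    simp only [Finset.sum_insert ha]
    have h1 : ContMDiff (𝓡 d) 𝓘(ℝ, ℝ) ∞ (fun y => c a * f a y) := contMDiff_const.mul (hf a)
    have h2 : ContMDiff (𝓡 d) 𝓘(ℝ, ℝ) ∞ (fun y => ∑ i ∈ s, c i * f i y) :=
      contMDiff_finsetSum fun i _ => contMDiff_const.mul (hf i)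
    have h3 := congrArg (fun L => L v) (mvfderiv_add ((h1 x).mdifferentiableAt (by simp))
      ((h2 x).mdifferentiableAt (by simp)))
    have h4 := mvfderiv_mul_apply (f₁ := fun _ => c a) contMDiff_const (hf a) x v
    simp only [mvfderiv_const, _root_.zero_apply, mul_zero, add_zero] at h4
    rw [← ih, ← h4]
    exact h3

end DerivativeSum

section Combinations

variable {d : ℕ} {M : Type*} [TopologicalSpace M] [ChartedSpace (EuclideanSpace ℝ (Fin d)) M]
  [IsManifold (𝓡 d) ∞ M]

theorem smooth_sum_smul {ι : Type*} (s : Finset ι) (c : ι → ℝ) {Y : ι → VField d M}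
    (hY : ∀ i, (Y i).Smooth) : VField.Smooth (fun y => ∑ i ∈ s, c i • Y i y) :=
  ContMDiff.sum_section fun i _ => ContMDiff.const_smul_section (a := c i) (hY i)

theorem mlieBracket_sum_smul_right {ι : Type*} (s : Finset ι) (c : ι → ℝ) (X : VField d M)
    {Y : ι → VField d M} (hY : ∀ i, (Y i).Smooth) (x : M) :
    VectorField.mlieBracket (𝓡 d) X (fun y => ∑ i ∈ s, c i • Y i y) x =
      ∑ i ∈ s, c i • VectorField.mlieBracket (𝓡 d) X (Y i) x := by
  classical
  induction s using Finset.induction_on with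
  | empty =>
    simp only [Finset.sum_empty]
    exact congrFun (VectorField.mlieBracket_zero_right (I := 𝓡 d) (W := X)) x
  | insert a s ha ih =>
    simp only [Finset.sum_insert ha]
    have h1 : VField.Smooth (c a • Y a) := ContMDiff.const_smul_section (hY a)
    have h2 := smooth_sum_smul s c hY
    rw [← ih, ← VectorField.mlieBracket_const_smul_right ((hY a).mdifferentiableAt x)]
    exact VectorField.mlieBracket_add_right (V := X) (h1.mdifferentiableAt x)
      (h2.mdifferentiableAt x)

theorem koszul_sum_smul_middle {ι : Type*} (s : Finset ι) (c : ι → ℝ) (g : SmoothMetric d M)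
    {X Z : VField d M} {Y : ι → VField d M} (hX : X.Smooth) (hY : ∀ i, (Y i).Smooth)
    (hZ : Z.Smooth) (x : M) :
    koszul g X (fun y => ∑ i ∈ s, c i • Y i y) Z x = ∑ i ∈ s, c i * koszul g X (Y i) Z x := by
  have hg : BilinField.Smooth (fun x => g.inner x) := g.contMDiff
  have h1 := mvfderiv_sum_mul_apply s c (fun i => hg.apply (hY i) hZ) x (X x)
  have h2 := mvfderiv_sum_mul_apply s c (fun i => hg.apply hX (hY i)) x (Z x)
  unfold koszul
  rw [VectorField.mlieBracket_swap_apply (V := fun y => ∑ i ∈ s, c i • Y i y) (W := Z)]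
  simp only [mlieBracket_sum_smul_right s c _ hY, map_sum, map_smul, _root_.sum_apply,
    _root_.smul_apply, smul_eq_mul, h1, h2, map_neg, _root_.neg_apply]
  simp only [VectorField.mlieBracket_swap_apply (V := Z), map_neg, _root_.neg_apply,
    ← Finset.sum_sub_distrib, ← Finset.sum_add_distrib, ← Finset.sum_neg_distrib]
  refine Finset.sum_congr rfl fun i _ => ?_
  ring

theorem koszul_sum_smul_right {ι : Type*} (s : Finset ι) (c : ι → ℝ) (g : SmoothMetric d M)
    {X Y : VField d M} {Z : ι → VField d M} (hX : X.Smooth) (hY : Y.Smooth)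
    (hZ : ∀ i, (Z i).Smooth) (x : M) :
    koszul g X Y (fun y => ∑ i ∈ s, c i • Z i y) x = ∑ i ∈ s, c i * koszul g X Y (Z i) x := by
  have hg : BilinField.Smooth (fun x => g.inner x) := g.contMDiff
  have h1 := mvfderiv_sum_mul_apply s c (fun i => hg.apply hY (hZ i)) x (X x)
  have h2 := koszul_sum_smul_middle s c g hX hZ hY x
  -- Metric compatibility exchanges the last two slots and so reduces this to linearity in the
  -- middle one.
  have h3 := koszul_add_swap g X Y (fun y => ∑ i ∈ s, c i • Z i y) x
  have h4 : ∀ i, koszul g X Y (Z i) x =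
      2 * mvfderiv (𝓡 d) (fun y => g.inner y (Y y) (Z i y)) x (X x) - koszul g X (Z i) Y x :=
    fun i => eq_sub_of_add_eq (koszul_add_swap g X Y (Z i) x)
  simp only [map_sum, map_smul, smul_eq_mul, h1, h2] at h3
  simp only [h4, mul_sub, Finset.sum_sub_distrib]
  rw [eq_sub_iff_add_eq, h3, Finset.mul_sum]
  exact Finset.sum_congr rfl fun i _ => by ring

theorem dOne_sum_smul {ι : Type*} (s : Finset ι) (c : ι → ℝ) {η : ι → CovField d M}
    (hη : ∀ i, (η i).Smooth) {X Y : VField d M} (hX : X.Smooth) (hY : Y.Smooth) (x : M) :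
    dOne (fun y => ∑ i ∈ s, c i • η i y) X Y x = ∑ i ∈ s, c i * dOne (η i) X Y x := by
  have h1 := mvfderiv_sum_mul_apply s c (fun i => (hη i).apply hY) x (X x)
  have h2 := mvfderiv_sum_mul_apply s c (fun i => (hη i).apply hX) x (Y x)
  unfold dOne
  simp only [_root_.sum_apply, _root_.smul_apply, smul_eq_mul, h1, h2,
    ← Finset.sum_sub_distrib, Finset.mul_sum]
  exact Finset.sum_congr rfl fun i _ => by ring

/-- A contact metric structure satisfying the Sasakian formula for the Levi-Civita derivative of
its structure tensor is normal. -/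
theorem isNormal_of_koszul_phi [T2Space M] {φ : EndField d M} {ξ : VField d M} {η : CovField d M}
    {g : SmoothMetric d M} (h : IsAlmostContact φ ξ η) (hg : IsCompatibleMetric g φ η)
    (hd : ∀ X Y : VField d M, X.Smooth → Y.Smooth →
      ∀ x : M, dOne η X Y x = fundamentalForm g φ x (X x) (Y x))
    (hK : ∀ X Y Z : VField d M, X.Smooth → Y.Smooth → Z.Smooth → ∀ x : M,
      koszul g X (fun y => φ y (Y y)) Z x + koszul g X Y (fun y => φ y (Z y)) x =
        2 * (g.inner x (X x) (Y x) * η x (Z x) - η x (Y x) * g.inner x (X x) (Z x))) :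
    IsNormal φ ξ η := by
  intro X Y hX hY x
  by_contra hne
  -- `Z` extends the normality tensor itself, so vanishing of its pairing with `Z` contradicts
  -- positivity of `g`.
  obtain ⟨Z, hZ, hZx⟩ := exists_smooth_vField_eq x (nijenhuis φ X Y x + (2 * dOne η X Y x) • ξ x)
  suffices key : g.inner x (nijenhuis φ X Y x + (2 * dOne η X Y x) • ξ x) (Z x) = 0 by
    have hpos := g.pos x _ hne
    rw [hZx] at key
    exact hpos.ne' key
  rw [hd X Y hX hY, fundamentalForm_apply]
  have hφX := h.smooth_phi.apply hX
  have hφY := h.smooth_phi.apply hY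
  have hφZ := h.smooth_phi.apply hZ
  have skew := hg.skew h
  -- Torsion-freeness gives `[φ, φ](X, Y) = (∇_{φX} φ) Y - (∇_{φY} φ) X - φ (∇_X φ) Y + φ (∇_Y φ)
  -- X`. The outer `φ` is moved onto `Z` by skewness, whence the instances `d3` and `d4` at `φ Z`;
  -- `b1` to `b4` turn brackets into covariant derivatives.
  have d1 := hK _ Y Z hφX hY hZ x
  have d2 := hK _ X Z hφY hX hZ x
  have d3 := hK X Y _ hX hY hφZ x
  have d4 := hK Y X _ hY hX hφZ x
  have b1 := koszul_sub_swap g X Y (fun y => φ y (φ y (Z y))) x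
  have b2 := koszul_sub_swap g (fun y => φ y (X y)) (fun y => φ y (Y y)) Z x
  have b3 := koszul_sub_swap g (fun y => φ y (X y)) Y (fun y => φ y (Z y)) x
  have b4 := koszul_sub_swap g X (fun y => φ y (Y y)) (fun y => φ y (Z y)) x
  simp only [h.eta_phi, skew, mul_zero] at d1 d2 d3 d4
  simp only [nijenhuis, map_add, map_sub, map_smul, _root_.add_apply, _root_.sub_apply,
    _root_.smul_apply, smul_eq_mul, skew, g.symm x (ξ x), hg.inner_xi h]
  have s := skew x (Y x) (X x)
  rw [g.symm] at s
  linear_combination (1 / 2 : ℝ) * (d1 - d2 + d3 - d4 - b1 - b2 - b3 - b4)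
    + η x (Z x) * s

end Combinations

/-! ### Combinations of tensor fields over the sphere -/

theorem sum_fin_three {A : Type*} [AddCommMonoid A] (f : Fin (2 + 1) → A) :
    ∑ i, f i = f (0 : Fin 3) + f (1 : Fin 3) + f (2 : Fin 3) :=
  Fin.sum_univ_three f

section SphereComb

variable {d : ℕ} {M : Type*} [TopologicalSpace M] [ChartedSpace (EuclideanSpace ℝ (Fin d)) M]

theorem sphereComb_end_apply {p : ℕ} (l : USphere p) (φ : Fin (p + 1) → EndField d M) (x : M)
    (v : TangentSpace (𝓡 d) x) : sphereComb l φ x v = ∑ i, l.1 i • φ i x v := by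
  simp only [sphereComb, _root_.sum_apply, _root_.smul_apply]

theorem sphereComb_cov_apply {p : ℕ} (l : USphere p) (η : Fin (p + 1) → CovField d M) (x : M)
    (v : TangentSpace (𝓡 d) x) : sphereComb l η x v = ∑ i, l.1 i * η i x v := by
  simp only [sphereComb, _root_.sum_apply, _root_.smul_apply, smul_eq_mul]

theorem USphere.sum_sq {p : ℕ} (l : USphere p) : ∑ i, l.1 i * l.1 i = 1 := by
  have h : ‖l.1‖ = 1 := mem_sphere_zero_iff_norm.1 l.2
  have h2 := EuclideanSpace.real_norm_sq_eq l.1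
  rw [h] at h2
  simpa [pow_two] using h2.symm

/-- Equate the two expressions for the third structure tensor. These are the cross terms needed to
square `∑ λ_a φ_a`. -/
theorem ThreeStructureRelations.phi_anticomm {φ : Fin 3 → EndField d M}
    {ξ : Fin 3 → VField d M} {η : Fin 3 → CovField d M} (h : ThreeStructureRelations φ ξ η)
    (a : Fin 3) (x : M) (v : TangentSpace (𝓡 d) x) :
    φ a x (φ (a + 1) x v) + φ (a + 1) x (φ a x v) =
      η (a + 1) x v • ξ a x + η a x v • ξ (a + 1) x := by
  have h1 := h.phi_left a x v
  rw [h.phi_right a x v] at h1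
  linear_combination (norm := module) -h1

variable [IsManifold (𝓡 d) ∞ M]

theorem fundamentalForm_sphereComb {p : ℕ} (g : SmoothMetric d M) (l : USphere p)
    (φ : Fin (p + 1) → EndField d M) :
    fundamentalForm g (sphereComb l φ) = sphereComb l (fun a => fundamentalForm g (φ a)) := by
  funext x
  ext v w
  rw [fundamentalForm_apply, sphereComb_end_apply]
  simp only [sphereComb, _root_.sum_apply, _root_.smul_apply, smul_eq_mul, map_sum, map_smul,
    fundamentalForm_apply]

theorem sphereComb_vField_smooth {p : ℕ} (l : USphere p) {X : Fin (p + 1) → VField d M}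
    (hX : ∀ i, (X i).Smooth) : VField.Smooth (sphereComb l X) :=
  smooth_sum_smul _ _ hX

theorem sphereComb_covField_smooth {p : ℕ} (l : USphere p) {η : Fin (p + 1) → CovField d M}
    (hη : ∀ i, (η i).Smooth) : CovField.Smooth (sphereComb l η) :=
  ContMDiff.sum_section fun i _ => ContMDiff.const_smul_section (a := l.1 i) (hη i)

theorem sphereComb_endField_smooth {p : ℕ} (l : USphere p) {φ : Fin (p + 1) → EndField d M}
    (hφ : ∀ i, (φ i).Smooth) : EndField.Smooth (sphereComb l φ) :=
  ContMDiff.sum_section fun i _ => ContMDiff.const_smul_section (a := l.1 i) (hφ i)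

end SphereComb

/-! ### Reeb fields, and the members of a 3-Sasakian sphere -/

section Reeb

variable {d : ℕ} {M : Type*} [TopologicalSpace M] [ChartedSpace (EuclideanSpace ℝ (Fin d)) M]
  [IsManifold (𝓡 d) ∞ M]
  {φ : EndField d M} {ξ : VField d M} {η : CovField d M} {g : SmoothMetric d M}

theorem IsSasakian.isTwoForm (h : IsSasakian φ ξ η g) : IsTwoForm (fundamentalForm g φ) where
  smooth := fundamentalForm_smooth g h.almost_contact.smooth_phi
  alternating x v := by
    have h1 := h.compatible.skew h.almost_contact x v v
    rw [g.symm] at h1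
    rw [fundamentalForm_apply]
    linarith

theorem IsSasakian.isReeb (h : IsSasakian φ ξ η g) : IsReeb η (fundamentalForm g φ) ξ where
  smooth := h.almost_contact.smooth_xi
  one := h.almost_contact.eta_xi
  two x := by
    ext w
    have h1 := h.compatible.skew h.almost_contact x (ξ x) w
    rw [h.almost_contact.phi_xi, map_zero, _root_.zero_apply] at h1
    rw [fundamentalForm_apply, _root_.zero_apply]
    linarith

end Reeb

section ThreeSasakian

variable {d : ℕ} {M : Type*} [TopologicalSpace M] [ChartedSpace (EuclideanSpace ℝ (Fin d)) M]
  [IsManifold (𝓡 d) ∞ M]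
  {φ : Fin 3 → EndField d M} {ξ : Fin 3 → VField d M} {η : Fin 3 → CovField d M}
  {g : SmoothMetric d M}

theorem IsThreeSasakian.isAlmostContact_sphereComb (h : IsThreeSasakian φ ξ η g) (l : USphere 2) :
    IsAlmostContact (sphereComb l φ) (sphereComb l ξ) (sphereComb l η) where
  smooth_phi := sphereComb_endField_smooth l fun i => (h.sasakian i).almost_contact.smooth_phi
  smooth_xi := sphereComb_vField_smooth l fun i => (h.sasakian i).almost_contact.smooth_xi
  smooth_eta := sphereComb_covField_smooth l fun i => (h.sasakian i).almost_contact.smooth_eta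
  phi_phi x v := by
    have hl := USphere.sum_sq l
    have a0 := h.relations.phi_anticomm 0 x v
    have a1 := h.relations.phi_anticomm 1 x v
    have a2 := h.relations.phi_anticomm 2 x v
    have s0 := (h.sasakian 0).almost_contact.phi_phi x v
    have s1 := (h.sasakian 1).almost_contact.phi_phi x v
    have s2 := (h.sasakian 2).almost_contact.phi_phi x v
    have e1 : (0 : Fin 3) + 1 = 1 := rfl
    have e2 : (1 : Fin 3) + 1 = 2 := rfl
    have e3 : (2 : Fin 3) + 1 = 0 := rfl
    rw [e1] at a0
    rw [e2] at a1
    rw [e3] at a2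
    simp only [sphereComb_end_apply, sphereComb_cov_apply]
    simp only [sphereComb, sum_fin_three, map_add, map_smul] at hl ⊢
    -- The squares contribute `-|λ|² v` together with the diagonal part of `η_λ(v) ξ_λ`; the
    -- anticommutators supply its off-diagonal part.
    linear_combination (norm := module) (l.1 0 * l.1 0) • s0 + (l.1 1 * l.1 1) • s1
      + (l.1 2 * l.1 2) • s2 + (l.1 0 * l.1 1) • a0 + (l.1 1 * l.1 2) • a1
      + (l.1 2 * l.1 0) • a2 - hl • v
  eta_xi x := by
    have hl := USphere.sum_sq l
    -- The mixed values `η_b (ξ_a)` vanish: `η_b` factors through `φ_a` up to sign, and `φ_a ξ_a =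
    -- 0`.
    have z1 : ∀ a, η (a + 2) x (ξ (a + 1) x) = 0 := fun a => by
      rw [h.relations.eta_left, (h.sasakian (a + 1)).almost_contact.phi_xi, map_zero]
    have z2 : ∀ a, η (a + 2) x (ξ a x) = 0 := fun a => by
      rw [h.relations.eta_right, (h.sasakian a).almost_contact.phi_xi, map_zero, neg_zero]
    have o : ∀ a, η a x (ξ a x) = 1 := fun a => (h.sasakian a).almost_contact.eta_xi x
    have c0 : η 2 x (ξ 1 x) = 0 := z1 0
    have c1 : η 0 x (ξ 2 x) = 0 := z1 1
    have c2 : η 1 x (ξ 0 x) = 0 := z1 2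
    have c3 : η 2 x (ξ 0 x) = 0 := z2 0
    have c4 : η 0 x (ξ 1 x) = 0 := z2 1
    have c5 : η 1 x (ξ 2 x) = 0 := z2 2
    simp only [sphereComb_cov_apply]
    simp only [sphereComb, sum_fin_three, map_add, map_smul, smul_eq_mul, o, c0, c1, c2, c3,
      c4, c5] at hl ⊢
    linear_combination hl

/-- Skewness of `φ_λ` and metric duality of `ξ_λ` and `η_λ` are linear in `λ`. Together with the
formula for `φ_λ²` they give compatibility without expanding squares. -/
theorem IsThreeSasakian.isCompatibleMetric_sphereComb (h : IsThreeSasakian φ ξ η g)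
    (l : USphere 2) : IsCompatibleMetric g (sphereComb l φ) (sphereComb l η) := by
  intro x v w
  have hskew : ∀ v w : TangentSpace (𝓡 d) x,
      g.inner x v (sphereComb l φ x w) = -g.inner x (sphereComb l φ x v) w := by
    intro v w
    simp only [sphereComb_end_apply, map_sum, map_smul, _root_.sum_apply, _root_.smul_apply,
      smul_eq_mul, (h.sasakian _).compatible.skew (h.sasakian _).almost_contact, mul_neg,
      Finset.sum_neg_distrib, neg_neg]
  have hxi : g.inner x (sphereComb l ξ x) w = sphereComb l η x w := by
    rw [g.symm, sphereComb_cov_apply]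
    simp only [sphereComb, map_sum, map_smul, smul_eq_mul,
      (h.sasakian _).compatible.inner_xi (h.sasakian _).almost_contact]
  rw [hskew, (h.isAlmostContact_sphereComb l).phi_phi]
  simp only [map_add, map_neg, map_smul, _root_.add_apply, _root_.neg_apply, _root_.smul_apply,
    smul_eq_mul, hxi]
  ring

theorem IsThreeSasakian.isSasakian_sphereComb [T2Space M] (h : IsThreeSasakian φ ξ η g)
    (l : USphere 2) : IsSasakian (sphereComb l φ) (sphereComb l ξ) (sphereComb l η) g := by
  have hac := h.isAlmostContact_sphereComb l
  have hg := h.isCompatibleMetric_sphereComb l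
  have hd : ∀ X Y : VField d M, X.Smooth → Y.Smooth → ∀ x : M,
      dOne (sphereComb l η) X Y x = fundamentalForm g (sphereComb l φ) x (X x) (Y x) := by
    intro X Y hX hY x
    rw [fundamentalForm_apply, sphereComb_end_apply]
    simp only [map_sum, map_smul, smul_eq_mul]
    refine (dOne_sum_smul _ _ (fun i => (h.sasakian i).almost_contact.smooth_eta) hX hY x).trans ?_
    exact Finset.sum_congr rfl fun i _ => by
      rw [(h.sasakian i).contact X Y hX hY, fundamentalForm_apply]
  refine ⟨hac, hg, isNormal_of_koszul_phi hac hg hd fun X Y Z hX hY hZ x => ?_, hd⟩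
  have hφ := fun i => (h.sasakian i).almost_contact.smooth_phi
  simp only [sphereComb_end_apply, sphereComb_cov_apply]
  rw [koszul_sum_smul_middle _ _ g hX (fun i => (hφ i).apply hY) hZ,
    koszul_sum_smul_right _ _ g hX hY (fun i => (hφ i).apply hZ), ← Finset.sum_add_distrib,
    Finset.mul_sum, Finset.sum_mul, ← Finset.sum_sub_distrib, Finset.mul_sum]
  refine Finset.sum_congr rfl fun i _ => ?_
  rw [← mul_add, (h.sasakian i).koszul_phi hX hY hZ]
  ring

end ThreeSasakian

/-! ### Signs of permutations preserving a pairing -/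

section PairForm

/-- The standard alternating form on a basis indexed by `Option (α × Bool)`: the pairs
`(j, false), (j, true)` are hyperbolic and mutually orthogonal, and `none` is in the radical. -/
def pairForm {α : Type*} [DecidableEq α] : Option (α × Bool) → Option (α × Bool) → ℝ
  | some (i, false), some (j, true) => if i = j then 1 else 0
  | some (i, true), some (j, false) => if i = j then -1 else 0
  | _, _ => 0

theorem pairForm_ne_zero {α : Type*} [DecidableEq α] {p q : α × Bool}
    (h : pairForm (some p) (some q) ≠ 0) :
    q = (p.1, !p.2) ∧ pairForm (some p) (some q) = if p.2 then -1 else 1 := by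
  obtain ⟨i, b⟩ := p
  obtain ⟨j, c⟩ := q
  cases b <;> cases c <;> simp_all [pairForm]

variable {α : Type*} [DecidableEq α] [Fintype α]

/-- Nonvanishing forces `ρ` to carry pairs to pairs, so `ρ` is a permutation `τ` of the pairs
composed with flips inside them. Since `τ` acts on both members of each pair it contributes `(sign
τ)² = 1`, and each flip changes both the sign and one factor of the product. -/
theorem sign_mul_prod_pairForm_some (ρ : Equiv.Perm (α × Bool))
    (h : ∀ j, pairForm (some (ρ (j, false))) (some (ρ (j, true))) ≠ 0) :
    (Equiv.Perm.sign ρ : ℝ) * ∏ j, pairForm (some (ρ (j, false))) (some (ρ (j, true))) = 1 := by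
  have hq : ∀ j, ρ (j, true) = ((ρ (j, false)).1, !(ρ (j, false)).2) :=
    fun j => (pairForm_ne_zero (h j)).1
  have hinj : Function.Injective fun j => (ρ (j, false)).1 := by
    intro i j hij
    simp only at hij
    by_cases hb : (ρ (i, false)).2 = (ρ (j, false)).2
    · exact congrArg Prod.fst (ρ.injective (Prod.ext hij hb))
    · have h1 : ρ (i, true) = ρ (j, false) := by
        rw [hq i]
        refine Prod.ext hij ?_
        revert hb
        cases (ρ (i, false)).2 <;> cases (ρ (j, false)).2 <;> simp
      exact congrArg Prod.fst (ρ.injective h1)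
  let τ : Equiv.Perm α := Equiv.ofBijective _ (Finite.injective_iff_bijective.1 hinj)
  let δ : α → Equiv.Perm Bool := fun j => if (ρ (j, false)).2 then Equiv.swap false true else 1
  have hρ : ρ = (Equiv.prodCongrLeft fun _ : Bool => τ) * Equiv.prodCongrRight δ := by
    ext1 ⟨j, b⟩
    have h1 : τ j = (ρ (j, false)).1 := rfl
    have h2 : ((Equiv.prodCongrLeft fun _ : Bool => τ) * Equiv.prodCongrRight δ) (j, b) =
      (τ j, δ j b) := rfl
    rw [h2, h1]
    have h3 := hq j
    cases b
    · refine Prod.ext rfl ?_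
      simp only [δ]
      cases (ρ (j, false)).2 <;> simp
    · rw [h3]
      refine Prod.ext rfl ?_
      simp only [δ]
      cases (ρ (j, false)).2 <;> simp
  have hδ : ∀ j, pairForm (some (ρ (j, false))) (some (ρ (j, true))) =
      ((Equiv.Perm.sign (δ j) : ℤ) : ℝ) := by
    intro j
    rw [(pairForm_ne_zero (h j)).2]
    simp only [δ]
    cases (ρ (j, false)).2 <;> simp
  have hsign : Equiv.Perm.sign ρ = ∏ j, Equiv.Perm.sign (δ j) := by
    conv_lhs => rw [hρ]
    rw [map_mul, Equiv.Perm.sign_prodCongrLeft, Equiv.Perm.sign_prodCongrRight]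
    simp
  simp only [hδ, hsign]
  push_cast
  rw [← Finset.prod_mul_distrib]
  refine Finset.prod_eq_one fun j _ => ?_
  rcases Int.units_eq_one_or (Equiv.Perm.sign (δ j)) with h | h <;> simp [h]

theorem sign_mul_prod_pairForm (σ : Equiv.Perm (Option (α × Bool))) (h0 : σ none = none)
    (h : ∀ j, pairForm (σ (some (j, false))) (σ (some (j, true))) ≠ 0) :
    (Equiv.Perm.sign σ : ℝ) * ∏ j, pairForm (σ (some (j, false))) (σ (some (j, true))) = 1 := by
  have h1 := map_equiv_removeNone σ
  rw [h0, Equiv.swap_self] at h1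
  have h2 : σ = (Equiv.removeNone σ).optionCongr := by rw [h1]; rfl
  have h3 : ∀ p, σ (some p) = some (Equiv.removeNone σ p) := fun p => by
    conv_lhs => rw [h2]
    rfl
  have h4 : Equiv.Perm.sign σ = Equiv.Perm.sign (Equiv.removeNone σ) := by
    conv_lhs => rw [h2]
    exact Equiv.optionCongr_sign _
  simp only [h3] at h ⊢
  rw [h4]
  exact sign_mul_prod_pairForm_some _ h

end PairForm

/-! ### The wedge product on an adapted frame -/

section WedgeValue

/-- The enumeration of `Option (Fin k × Bool)` underlying `tensorOneTwoPow`. -/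
def pairIndex (k : ℕ) : Option (Fin k × Bool) ≃ Fin (2 * k + 1) :=
  Equiv.ofBijective
    (fun a => match a with
      | none => 0
      | some (j, false) => ⟨2 * j.1 + 1, by omega⟩
      | some (j, true) => ⟨2 * j.1 + 2, by omega⟩)
    ((Fintype.bijective_iff_injective_and_card _).2 ⟨by
      rintro (_ | ⟨i, _ | _⟩) (_ | ⟨j, _ | _⟩) h <;>
        simp only [Fin.ext_iff, Fin.val_zero] at h <;> first | rfl | omega | skip
      all_goals
        have : i = j := Fin.ext (by omega)
        rw [this], by simp; ring⟩)

variable {V : Type*} [AddCommGroup V] [Module ℝ V] [TopologicalSpace V]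

theorem tensorOneTwoPow_pairIndex {k : ℕ} (η : V →L[ℝ] ℝ) (Ω : V →L[ℝ] V →L[ℝ] ℝ)
    (v : Fin (2 * k + 1) → V) :
    tensorOneTwoPow k η Ω v = η (v (pairIndex k none)) *
      ∏ j, Ω (v (pairIndex k (some (j, false)))) (v (pairIndex k (some (j, true)))) := rfl

theorem wedgeOneTwoPow_apply (k : ℕ) (η : V →L[ℝ] ℝ) (Ω : V →L[ℝ] V →L[ℝ] ℝ)
    (v : Fin (2 * k + 1) → V) :
    wedgeOneTwoPow k η Ω v = (1 / 2 ^ k : ℝ) *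
      ∑ σ : Equiv.Perm (Fin (2 * k + 1)),
        (Equiv.Perm.sign σ : ℝ) * tensorOneTwoPow k η Ω (fun i => v (σ i)) := by
  simp only [wedgeOneTwoPow, AlternatingMap.smul_apply, MultilinearMap.alternatization_apply,
    MultilinearMap.domDomCongr_apply, smul_eq_mul, Units.smul_def, zsmul_eq_mul]

/-- The value of `η ∧ Ω ^ k` on an adapted frame. -/
def adaptedWedgeValue (k : ℕ) : ℝ :=
  (1 / 2 ^ k : ℝ) * ∑ σ : Equiv.Perm (Option (Fin k × Bool)), (Equiv.Perm.sign σ : ℝ) *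
    ((σ none).elim 1 (fun _ => 0) *
      ∏ j, pairForm (σ (some (j, false))) (σ (some (j, true))))

/-- Each term of the sum is `0` or `1`, and the identity contributes `1`. The exact value is never
needed. -/
theorem adaptedWedgeValue_pos (k : ℕ) : 0 < adaptedWedgeValue k := by
  refine mul_pos (by positivity) (Finset.sum_pos' (fun σ _ => ?_) ⟨1, Finset.mem_univ _, ?_⟩)
  · by_cases h0 : σ none = none
    · by_cases h : ∀ j, pairForm (σ (some (j, false))) (σ (some (j, true))) ≠ 0
      · rw [h0, Option.elim_none, one_mul, sign_mul_prod_pairForm σ h0 h]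
        exact zero_le_one
      · push Not at h
        obtain ⟨j, hj⟩ := h
        rw [Finset.prod_eq_zero (Finset.mem_univ j) hj]
        simp
    · obtain ⟨p, hp⟩ := Option.ne_none_iff_exists'.1 h0
      simp [hp]
  · simp [pairForm]

theorem wedgeOneTwoPow_adapted {k : ℕ} {η : V →L[ℝ] ℝ} {Ω : V →L[ℝ] V →L[ℝ] ℝ}
    {u : Option (Fin k × Bool) → V} (hη : ∀ a, η (u a) = a.elim 1 fun _ => 0)
    (hΩ : ∀ a b, Ω (u a) (u b) = pairForm a b) :
    wedgeOneTwoPow k η Ω (fun i => u ((pairIndex k).symm i)) = adaptedWedgeValue k := by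
  rw [wedgeOneTwoPow_apply, adaptedWedgeValue]
  congr 1
  refine Fintype.sum_equiv (pairIndex k).symm.permCongr _ _ fun σ => ?_
  rw [tensorOneTwoPow_pairIndex, Equiv.Perm.sign_permCongr]
  simp only [hη, hΩ, Equiv.permCongr_apply, Equiv.symm_symm]

end WedgeValue

/-! ### Orthonormal families and top-degree forms -/

section OrthonormalFamily

variable {V ι : Type*} [AddCommGroup V] [Module ℝ V] [TopologicalSpace V] [Fintype ι]
  [DecidableEq ι]

theorem linearIndependent_of_gram {B : V →L[ℝ] V →L[ℝ] ℝ} {v : ι → V}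
    (hv : ∀ i j, B (v i) (v j) = if i = j then 1 else 0) : LinearIndependent ℝ v := by
  rw [Fintype.linearIndependent_iff]
  intro c hc i
  have h := congrArg (B (v i)) hc
  simpa [hv] using h

/-- An alternating form of top degree takes the same value, up to sign, on any two orthonormal
families. -/
theorem AlternatingMap.apply_eq_or_neg_of_gram {B : V →L[ℝ] V →L[ℝ] ℝ} [FiniteDimensional ℝ V]
    [Nonempty ι]
    (hcard : Fintype.card ι = Module.finrank ℝ V) {v w : ι → V}
    (hv : ∀ i j, B (v i) (v j) = if i = j then 1 else 0)
    (hw : ∀ i j, B (w i) (w j) = if i = j then 1 else 0) (f : V [⋀^ι]→ₗ[ℝ] ℝ) :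
    f w = f v ∨ f w = -f v := by
  set b := basisOfLinearIndependentOfCardEqFinrank (linearIndependent_of_gram hv) hcard
  have hbv : ⇑b = v := coe_basisOfLinearIndependentOfCardEqFinrank _ _
  have h1 : f w = f v * b.det w := by
    conv_lhs => rw [f.eq_smul_basis_det b]
    rw [hbv, AlternatingMap.smul_apply, smul_eq_mul]
  -- The change of frame is an orthogonal matrix, so its determinant is `±1`.
  have h2 : (b.toMatrix w).transpose * b.toMatrix w = 1 := by
    ext j l
    have hj : ∀ j, w j = ∑ i, b.toMatrix w i j • v i := fun j => by
      rw [← hbv]; exact (b.sum_toMatrix_smul_self w j).symm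
    have h3 := hw j l
    rw [hj j, hj l] at h3
    simp only [map_sum, map_smul, _root_.sum_apply, _root_.smul_apply, hv, smul_eq_mul, mul_ite,
      mul_one, mul_zero, Finset.sum_ite_eq', Finset.mem_univ, if_true] at h3
    rw [Matrix.mul_apply, Matrix.one_apply, ← h3]
    exact Finset.sum_congr rfl fun i _ => mul_comm _ _
  have h4 := congrArg Matrix.det h2
  rw [Matrix.det_mul, Matrix.det_transpose, Matrix.det_one, ← Module.Basis.det_apply,
    mul_self_eq_one_iff] at h4
  rcases h4 with h4 | h4 <;> simp [h1, h4]

end OrthonormalFamily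

/-! ### Adapted frames in an almost contact metric vector space -/

section ContactMetricSpace

variable {V : Type*} [AddCommGroup V] [Module ℝ V] [TopologicalSpace V]

/-- An almost contact metric structure on a vector space. -/
structure IsContactMetricSpace (B : V →L[ℝ] V →L[ℝ] ℝ) (φ : V →L[ℝ] V) (ξ : V) (η : V →L[ℝ] ℝ) :
    Prop where
  symm : ∀ v w, B v w = B w v
  pos : ∀ v, v ≠ 0 → 0 < B v v
  skew : ∀ v w, B (φ v) w = -B v (φ w)
  inner_xi : ∀ v, B v ξ = η v
  eta_xi : η ξ = 1
  eta_phi : ∀ v, η (φ v) = 0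
  phi_phi : ∀ v, φ (φ v) = -v + η v • ξ

/-- A unitary family in the contact distribution. -/
structure IsUnitaryFamily (B : V →L[ℝ] V →L[ℝ] ℝ) (φ : V →L[ℝ] V) (η : V →L[ℝ] ℝ) {k : ℕ}
    (e : Fin k → V) : Prop where
  gram : ∀ i j, B (e i) (e j) = if i = j then 1 else 0
  gram_phi : ∀ i j, B (e i) (φ (e j)) = 0
  eta : ∀ i, η (e i) = 0

/-- The frame `ξ, e_j, -φ e_j`. -/
def adaptedFrame (φ : V →L[ℝ] V) (ξ : V) {k : ℕ} (e : Fin k → V) : Option (Fin k × Bool) → V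
  | none => ξ
  | some (j, false) => e j
  | some (j, true) => -φ (e j)

variable {B : V →L[ℝ] V →L[ℝ] ℝ} {φ : V →L[ℝ] V} {ξ : V} {η : V →L[ℝ] ℝ} {k : ℕ} {e : Fin k → V}

theorem IsContactMetricSpace.inner_phi_phi (h : IsContactMetricSpace B φ ξ η) (v w : V) :
    B (φ v) (φ w) = B v w - η v * η w := by
  rw [h.skew, h.phi_phi, map_add, map_neg, map_smul, h.inner_xi, smul_eq_mul]
  ring

theorem IsUnitaryFamily.eta_adaptedFrame (h : IsContactMetricSpace B φ ξ η)
    (he : IsUnitaryFamily B φ η e) (a : Option (Fin k × Bool)) :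
    η (adaptedFrame φ ξ e a) = a.elim 1 fun _ => 0 := by
  rcases a with _ | ⟨i, _ | _⟩ <;> simp [adaptedFrame, h.eta_xi, he.eta, h.eta_phi]

theorem IsUnitaryFamily.gram_adaptedFrame (h : IsContactMetricSpace B φ ξ η)
    (he : IsUnitaryFamily B φ η e) (a b : Option (Fin k × Bool)) :
    B (adaptedFrame φ ξ e a) (adaptedFrame φ ξ e b) = if a = b then 1 else 0 := by
  rcases a with _ | ⟨i, _ | _⟩ <;> rcases b with _ | ⟨j, _ | _⟩ <;>
    simp [adaptedFrame, h.symm ξ, h.inner_xi, h.eta_xi, he.eta, h.eta_phi, he.gram, he.gram_phi,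
      h.phi_phi, h.skew]

/-- The minus sign in the frame is chosen for this: `B (e j) (φ (-φ (e j))) = B (e j) (e j) = 1`. -/
theorem IsUnitaryFamily.form_adaptedFrame (h : IsContactMetricSpace B φ ξ η)
    (he : IsUnitaryFamily B φ η e) (a b : Option (Fin k × Bool)) :
    B (adaptedFrame φ ξ e a) (φ (adaptedFrame φ ξ e b)) = pairForm a b := by
  have hξ : ∀ v, B ξ (φ v) = 0 := fun v => by rw [h.symm, h.inner_xi, h.eta_phi]
  have hξ' : ∀ v, B v (φ ξ) = 0 := fun v => by
    rw [← neg_eq_iff_eq_neg.2 (h.skew v ξ), h.inner_xi, h.eta_phi, neg_zero]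
  rcases a with _ | ⟨i, _ | _⟩ <;> rcases b with _ | ⟨j, _ | _⟩ <;>
    simp [adaptedFrame, pairForm, hξ, hξ', h.phi_phi, he.eta, he.gram, he.gram_phi,
      h.inner_phi_phi, h.skew, h.symm ξ, h.inner_xi]
  split_ifs <;> simp

/-- One Gram–Schmidt step: a vector outside the span, minus its projection, is orthogonal to `ξ`,
`e_j` and `φ e_j`. Normalized, it extends the family; skewness of `φ` gives the relations involving
`φ w`. -/
theorem IsContactMetricSpace.exists_unitaryFamily_succ (h : IsContactMetricSpace B φ ξ η)
    (he : IsUnitaryFamily B φ η e)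
    (hspan : Submodule.span ℝ (Set.range (adaptedFrame φ ξ e)) ≠ ⊤) :
    ∃ e' : Fin (k + 1) → V, IsUnitaryFamily B φ η e' := by
  obtain ⟨v, -, hv⟩ := SetLike.exists_of_lt hspan.lt_top
  set u := adaptedFrame φ ξ e with hu
  set w := v - ∑ a, B (u a) v • u a with hw
  have hw0 : w ≠ 0 := by
    intro h0
    apply hv
    rw [sub_eq_zero.1 h0]
    exact Submodule.sum_mem _ fun a _ => Submodule.smul_mem _ _ (Submodule.subset_span ⟨a, rfl⟩)
  have hort : ∀ a, B (u a) w = 0 := by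
    intro a
    rw [hw, map_sub, map_sum]
    simp [hu, he.gram_adaptedFrame h]
  have hpos := h.pos w hw0
  set c : ℝ := (Real.sqrt (B w w))⁻¹ with hc
  have hcc : c * (c * B w w) = 1 := by
    have h0 : Real.sqrt (B w w) ≠ 0 := (Real.sqrt_pos.2 hpos).ne'
    rw [hc]
    field_simp
    rw [Real.sq_sqrt hpos.le]
  have o1 : η w = 0 := by
    have := hort none
    rwa [h.symm, hu, adaptedFrame, h.inner_xi] at this
  have o2 : ∀ j, B (e j) w = 0 := fun j => hort (some (j, false))
  have o3 : ∀ j, B (φ (e j)) w = 0 := fun j => by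
    have := hort (some (j, true))
    simpa [hu, adaptedFrame] using this
  have o4 : B w (φ w) = 0 := by
    have := h.skew w w
    rw [h.symm] at this
    linarith
  have o5 : ∀ j, B (e j) (φ w) = 0 := fun j => by
    have := h.skew (e j) w
    rw [o3] at this
    linarith
  refine ⟨Fin.cons (c • w) e, ?_, ?_, ?_⟩
  · intro i j
    refine Fin.cases ?_ (fun i => ?_) i <;> refine Fin.cases ?_ (fun j => ?_) j <;>
      simp [he.gram, o2, h.symm w, hcc, Fin.succ_ne_zero, (Fin.succ_ne_zero _).symm]
  · intro i j
    refine Fin.cases ?_ (fun i => ?_) i <;> refine Fin.cases ?_ (fun j => ?_) j <;>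
      simp [he.gram_phi, o3, o4, o5, h.symm w]
  · intro i
    refine Fin.cases ?_ (fun i => ?_) i <;> simp [he.eta, o1]

theorem IsUnitaryFamily.le_finrank [FiniteDimensional ℝ V] (h : IsContactMetricSpace B φ ξ η)
    (he : IsUnitaryFamily B φ η e) : 2 * k + 1 ≤ Module.finrank ℝ V := by
  have h1 := (linearIndependent_of_gram (he.gram_adaptedFrame h)).fintype_card_le_finrank
  rwa [Fintype.card_congr (pairIndex k), Fintype.card_fin] at h1

/-- Sizes of unitary families are bounded by the dimension, and one of maximal size has a spanning
frame. Counting that frame shows the dimension is odd. -/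
theorem IsContactMetricSpace.exists_unitaryFamily [FiniteDimensional ℝ V]
    (h : IsContactMetricSpace B φ ξ η) :
    ∃ (k : ℕ) (e : Fin k → V), IsUnitaryFamily B φ η e ∧ Module.finrank ℝ V = 2 * k + 1 := by
  classical
  let P : ℕ → Prop := fun k => ∃ e : Fin k → V, IsUnitaryFamily B φ η e
  have hP0 : P 0 := ⟨Fin.elim0, fun i => i.elim0, fun i => i.elim0, fun i => i.elim0⟩
  have hbound : ∀ k, P k → k ≤ Module.finrank ℝ V := fun k ⟨e, he⟩ => by
    have := he.le_finrank h
    omega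
  obtain ⟨e, he⟩ : P (Nat.findGreatest P (Module.finrank ℝ V)) :=
    Nat.findGreatest_spec (Nat.zero_le _) hP0
  refine ⟨_, e, he, ?_⟩
  have hspan : Submodule.span ℝ (Set.range (adaptedFrame φ ξ e)) = ⊤ := by
    by_contra hne
    have hsucc : P _ := h.exists_unitaryFamily_succ he hne
    have := Nat.le_findGreatest (hbound _ hsucc) hsucc
    omega
  have h1 := finrank_span_eq_card (linearIndependent_of_gram (he.gram_adaptedFrame h))
  rw [hspan, finrank_top, Fintype.card_congr (pairIndex _), Fintype.card_fin] at h1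
  exact h1

end ContactMetricSpace

/-! ### Volume forms of the members, and tautness -/

section WedgeOnSphere

variable {d : ℕ} {M : Type*} [TopologicalSpace M] [ChartedSpace (EuclideanSpace ℝ (Fin d)) M]

instance tangentSpace_finiteDimensional (x : M) : FiniteDimensional ℝ (TangentSpace (𝓡 d) x) :=
  inferInstanceAs (FiniteDimensional ℝ (EuclideanSpace ℝ (Fin d)))

theorem finrank_tangentSpace_model (x : M) : Module.finrank ℝ (TangentSpace (𝓡 d) x) = d :=
  finrank_euclideanSpace_fin

theorem continuous_wedge_sphereComb {p : ℕ} (k : ℕ) (η : Fin (p + 1) → CovField d M)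
    (Ω : Fin (p + 1) → BilinField d M) (x : M)
    (v : Fin (2 * k + 1) → TangentSpace (𝓡 d) x) :
    Continuous fun l : USphere p =>
      wedgeOneTwoPow k (sphereComb l η x) (sphereComb l Ω x) v := by
  simp only [wedgeOneTwoPow_apply, tensorOneTwoPow_pairIndex, sphereComb, _root_.sum_apply,
    _root_.smul_apply, smul_eq_mul]
  fun_prop

variable [IsManifold (𝓡 d) ∞ M]

theorem IsSasakian.isContactMetricSpace {φ : EndField d M} {ξ : VField d M} {η : CovField d M}
    {g : SmoothMetric d M} (h : IsSasakian φ ξ η g) (x : M) :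
    IsContactMetricSpace (g.inner x) (φ x) (ξ x) (η x) where
  symm := g.symm x
  pos := g.pos x
  skew := h.compatible.skew h.almost_contact x
  inner_xi := h.compatible.inner_xi h.almost_contact x
  eta_xi := h.almost_contact.eta_xi x
  eta_phi := h.almost_contact.eta_phi x
  phi_phi := h.almost_contact.phi_phi x

theorem IsSasakian.exists_dim_eq [Nonempty M] {φ : EndField d M} {ξ : VField d M}
    {η : CovField d M} {g : SmoothMetric d M} (h : IsSasakian φ ξ η g) :
    ∃ k, d = 2 * k + 1 := by
  obtain ⟨x⟩ := ‹Nonempty M›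
  obtain ⟨k, -, -, hk⟩ := (h.isContactMetricSpace x).exists_unitaryFamily
  exact ⟨k, (finrank_tangentSpace_model x).symm.trans hk⟩

/-- `η ∧ Ω ^ k` has a universal positive value on some orthonormal frame. -/
theorem IsSasakian.exists_orthonormal_wedge_eq {φ : EndField d M} {ξ : VField d M}
    {η : CovField d M} {g : SmoothMetric d M} (h : IsSasakian φ ξ η g) {k : ℕ}
    (hk : d = 2 * k + 1) (x : M) :
    ∃ v : Fin (2 * k + 1) → TangentSpace (𝓡 d) x,
      (∀ i j, g.inner x (v i) (v j) = if i = j then 1 else 0) ∧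
      wedgeOneTwoPow k (η x) (fundamentalForm g φ x) v = adaptedWedgeValue k := by
  have hx := h.isContactMetricSpace x
  obtain ⟨k', e, he, hk'⟩ := hx.exists_unitaryFamily
  obtain rfl : k' = k := by
    rw [finrank_tangentSpace_model] at hk'
    omega
  refine ⟨fun i => adaptedFrame (φ x) (ξ x) e ((pairIndex k').symm i), fun i j => ?_,
    wedgeOneTwoPow_adapted (he.eta_adaptedFrame hx) fun a b => ?_⟩
  · rw [he.gram_adaptedFrame hx]
    simp
  · rw [fundamentalForm_apply, he.form_adaptedFrame hx]

theorem IsSasakian.isAlmostCosymplectic {φ : EndField d M} {ξ : VField d M}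
    {η : CovField d M} {g : SmoothMetric d M} (h : IsSasakian φ ξ η g) {k : ℕ}
    (hk : d = 2 * k + 1) : IsAlmostCosymplectic k η (fundamentalForm g φ) where
  dim_eq := hk
  smooth_one := h.almost_contact.smooth_eta
  two_form := h.isTwoForm
  volume x h0 := by
    obtain ⟨v, -, hv⟩ := h.exists_orthonormal_wedge_eq hk x
    rw [h0, AlternatingMap.zero_apply] at hv
    exact (adaptedWedgeValue_pos k).ne hv

theorem isTautSphere_of_isSasakian {φ : Fin 3 → EndField d M}
    {ξ : Fin 3 → VField d M} {η : Fin 3 → CovField d M} {g : SmoothMetric d M}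
    (h : ∀ l : USphere 2, IsSasakian (sphereComb l φ) (sphereComb l ξ) (sphereComb l η) g)
    {k : ℕ} (hk : d = 2 * k + 1) :
    IsTautSphere k (p := 2) η (fun a => fundamentalForm g (φ a)) := by
  intro l l' x
  have hcard : Fintype.card (Fin (2 * k + 1)) = Module.finrank ℝ (TangentSpace (𝓡 d) x) := by
    rw [finrank_tangentSpace_model, Fintype.card_fin, hk]
  obtain ⟨v, hv, -⟩ := (h l).exists_orthonormal_wedge_eq hk x
  have hval : ∀ m : USphere 2,
      wedgeOneTwoPow k (sphereComb m η x) (sphereComb m (fun a => fundamentalForm g (φ a)) x) v ^ 2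
        = adaptedWedgeValue k ^ 2 := by
    intro m
    obtain ⟨w, hw, hwv⟩ := (h m).exists_orthonormal_wedge_eq hk x
    rw [fundamentalForm_sphereComb] at hwv
    rw [← hwv, sq_eq_sq_iff_eq_or_eq_neg]
    exact AlternatingMap.apply_eq_or_neg_of_gram hcard hw hv _
  have hrank : 1 < Module.rank ℝ (EuclideanSpace ℝ (Fin (2 + 1))) := by
    rw [← Module.finrank_eq_rank, finrank_euclideanSpace_fin]
    norm_num
  have : PreconnectedSpace (USphere 2) :=
    isPreconnected_iff_preconnectedSpace.1 (isPreconnected_sphere hrank 0 1)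
  have hconn : IsPreconnected (Set.univ : Set (USphere 2)) := isPreconnected_univ
  have heq : wedgeOneTwoPow k (sphereComb l η x)
        (sphereComb l (fun a => fundamentalForm g (φ a)) x) v =
      wedgeOneTwoPow k (sphereComb l' η x)
        (sphereComb l' (fun a => fundamentalForm g (φ a)) x) v := by
    -- A continuous function on a connected space whose square is a nonzero constant has constant
    -- sign.
    rcases hconn.eq_or_eq_neg_of_sq_eq (continuous_wedge_sphereComb k η _ x v).continuousOn
      (continuousOn_const (c := adaptedWedgeValue k)) (fun m _ => hval m)
      (fun _ => (adaptedWedgeValue_pos k).ne') with h1 | h1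
    · exact (h1 (Set.mem_univ l)).trans (h1 (Set.mem_univ l')).symm
    · exact (h1 (Set.mem_univ l)).trans (h1 (Set.mem_univ l')).symm
  -- A top-degree form is determined by its value on the single basis `v`.
  set b := basisOfLinearIndependentOfCardEqFinrank (linearIndependent_of_gram hv) hcard
  have hbv : ⇑b = v := coe_basisOfLinearIndependentOfCardEqFinrank _ _
  rw [(wedgeOneTwoPow k (sphereComb l η x) _).eq_smul_basis_det b,
    (wedgeOneTwoPow k (sphereComb l' η x) _).eq_smul_basis_det b, hbv, heq]

end WedgeOnSphere

end

theorem mainTheorem10 {d : ℕ} {M : Type*} [TopologicalSpace M] [T2Space M] [Nonempty M]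
    [ChartedSpace (EuclideanSpace ℝ (Fin d)) M] [IsManifold (𝓡 d) ∞ M]
    (φ : Fin 3 → EndField d M) (ξ : Fin 3 → VField d M) (η : Fin 3 → CovField d M)
    (g : SmoothMetric d M) (h : IsThreeSasakian φ ξ η g) :
    ∃ k : ℕ,
      IsAlmostCosymplecticSphere k η (fun a => fundamentalForm g (φ a)) ∧
      IsTautSphere k η (fun a => fundamentalForm g (φ a)) ∧
      IsRoundSphere η (fun a => fundamentalForm g (φ a)) ∧
      ∀ l : USphere 2,
        IsSasakian (sphereComb l φ) (sphereComb l ξ) (sphereComb l η) g ∧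
        fundamentalForm g (sphereComb l φ) =
          sphereComb l (fun a => fundamentalForm g (φ a)) := by
  have hS := h.isSasakian_sphereComb
  obtain ⟨k, hk⟩ := (h.sasakian 0).exists_dim_eq
  refine ⟨k, ⟨fun i => (h.sasakian i).isAlmostCosymplectic hk, fun l => ?_⟩,
    isTautSphere_of_isSasakian hS hk, ⟨ξ, fun i => (h.sasakian i).isReeb, fun l => ?_⟩,
    fun l => ⟨hS l, fundamentalForm_sphereComb g l φ⟩⟩
  · rw [← fundamentalForm_sphereComb]
    exact (hS l).isAlmostCosymplectic hk
  · rw [← fundamentalForm_sphereComb]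
    exact (hS l).isReeb
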